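/- Fix a local dimension $d$. Let $\rho=(\rho_N)_{N\ge 1}$ be a family of operators on rings of $N$ sites, each site with Hilbert space $\mathbb C^d$. For $p\ge 1$ and matrices $\mathbb A^{ij}\in M_\chi(\mathbb C)$, where $i,j\in\{1,\dots,d\}^p$ run over the basis states of $p$ neighbouring sites, say that $\rho$ is generated by $\mathbb A$ with unit cell $p$ if, after grouping the sites into blocks of $p$ consecutive sites, $$\rho_{np}=\sum_{i_1,j_1,\dots,i_n,j_n}\operatorname{tr}\big(\mathbb A^{i_1j_1}\cdots\mathbb A^{i_nj_n}\big)\,|i_1\cdots i_n\rangle\langle j_1\cdots j_n|\qquad\text{for all } n\ge 1 .$$ * $\rho$ is an MPDO (matrix product density operator, not necessarily normalised) if for some $p\ge1$ it is generated with unit cell $p$ by some tensor $\mathbb A$ of some finite bond dimension $\chi$, and $\rho_{np}\ge 0$ for all $n\ge1$. * A tensor $\mathbb A$ is strong injective if (1) the linear map $\mathbb C^\chi\otimes\mathbb C^\chi\to\mathbb C^{d^p}\otimes\mathbb C^{d^p}$, $X\mapsto\big(\sum_{\alpha\beta}\mathbb A^{ij}_{\alpha\beta}X_{\alpha\beta}\big)_{ij}$,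 is injective, and (2) the transfer matrix $\mathbb T=\sum_i\mathbb A^{ii}$ has a unique largest eigenvalue: a real eigenvalue $\lambda>0$ of algebraic multiplicity one such that every other complex eigenvalue $\mu$ satisfies $|\mu|<\lambda$. * $\rho$ is strong injective if, after grouping some finite number $p\ge1$ of neighbouring sites, it is generated by a strong injective tensor. A quantum channel $X\mapsto\sum_aK_aXK_a^\dagger$, $\sum_aK_a^\dagger K_a=\mathbb 1$, is non-degenerate if it is injective on the space of all operators. A brickwork circuit of depth $t$ on a ring of an even number $N$ of sites is a composition of $t$ layers, numbered $0,\dots,t-1$; an even layer is a product of two-site channels on the pairs $(2k,2k+1)$ and an odd layer is one on the pairs $(2k+1,2k+2)$, with sites taken modulo $N$. The individual channels may differ from gate to gate and with $N$. **Proposition.** Let $t\ge0$, let $\rho$ and $\rho'$ be MPDOs, and suppose that for every even $N\ge2$ we have $\rho'_N=\mathcal N_N[\rho_N]$, where $\mathcal N_N$ is a brickwork circuit of depth $t$ all of whose two-site channels are non-degenerate. Then $\rho'$ is strong injective if and only if $\rho$ is strong injective. -/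

import Mathlib

noncomputable section

namespace StrongInjectiveMPDO

open Matrix
open scoped ComplexOrder

/-- Operators on a ring of `N` sites; `σ` indexes the standard basis of the one-site space. -/
abbrev ChainOp (σ : Type) (N : ℕ) : Type := Matrix (Fin N → σ) (Fin N → σ) ℂ

/-- A family of operators, one for every system size (local dimension `d`). -/
abbrev ChainFamily (d : ℕ) : Type := (N : ℕ) → ChainOp (Fin d) N

/-- A translationally invariant matrix product operator tensor: physical ket index, physical bra
index, and a `χ × χ` matrix on the virtual space. -/
abbrev LocalTensor (σ : Type) (χ : ℕ) : Type := σ → σ → Matrix (Fin χ) (Fin χ) ℂ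

/-- The operator `∑ tr (A^{i₁ j₁} ⋯ A^{i_N j_N}) |i₁ … i_N⟩⟨j₁ … j_N|`. -/
def mpdo {σ : Type} {χ : ℕ} (A : LocalTensor σ χ) (N : ℕ) : ChainOp σ N :=
  Matrix.of fun i j => ((List.ofFn fun x => A (i x) (j x)).prod).trace

/-- Grouping `p` neighbouring sites: the operator of the family on `n * p` sites, read as an
operator on `n` blocks of `p` consecutive sites (site `y` of block `x` is site `y + p * x`). -/
def grouped {d : ℕ} (p : ℕ) (ρ : ChainFamily d) (n : ℕ) : ChainOp (Fin p → Fin d) n :=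
  Matrix.of fun i j =>
    ρ (n * p) (fun s => i (finProdFinEquiv.symm s).1 (finProdFinEquiv.symm s).2)
      (fun s => j (finProdFinEquiv.symm s).1 (finProdFinEquiv.symm s).2)

/-- With unit cells of `p` sites, the family is generated by the tensor `A`. -/
def GeneratedBy {d χ : ℕ} (ρ : ChainFamily d) (p : ℕ) (A : LocalTensor (Fin p → Fin d) χ) : Prop :=
  ∀ n : ℕ, 1 ≤ n → grouped p ρ n = mpdo A n

/-- A matrix product density operator, not necessarily normalised: a positive semidefinite family
generated, for some finite unit cell, by one tensor independent of the system size. -/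
def IsMPDO {d : ℕ} (ρ : ChainFamily d) : Prop :=
  ∃ p : ℕ, 1 ≤ p ∧
    (∃ (χ : ℕ) (A : LocalTensor (Fin p → Fin d) χ), GeneratedBy ρ p A) ∧
    ∀ n : ℕ, 1 ≤ n → (ρ (n * p)).PosSemidef

/-- The tensor as a map from the virtual space `ℂ^χ ⊗ ℂ^χ` to the physical (ket and bra) space. -/
def virtualToPhysical {σ : Type} {χ : ℕ} (A : LocalTensor σ χ)
    (X : Matrix (Fin χ) (Fin χ) ℂ) : Matrix σ σ ℂ :=
  Matrix.of fun i j => ∑ α, ∑ β, A i j α β * X α β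

/-- The transfer matrix `∑ᵢ A^{ii}`. -/
def transferMatrix {σ : Type} [Fintype σ] {χ : ℕ} (A : LocalTensor σ χ) :
    Matrix (Fin χ) (Fin χ) ℂ :=
  ∑ i, A i i

/-- There is a positive real eigenvalue, of algebraic multiplicity one, and all other (complex)
eigenvalues are strictly smaller in modulus. -/
def HasUniqueLargestEigenvalue {χ : ℕ} (T : Matrix (Fin χ) (Fin χ) ℂ) : Prop :=
  ∃ r : ℝ, 0 < r ∧ T.charpoly.rootMultiplicity (r : ℂ) = 1 ∧
    ∀ z : ℂ, T.charpoly.IsRoot z → z ≠ (r : ℂ) → ‖z‖ < r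

/-- The two strong injectivity conditions on a tensor. -/
structure IsStrongInjectiveTensor {σ : Type} [Fintype σ] {χ : ℕ} (A : LocalTensor σ χ) : Prop where
  injective : Function.Injective (virtualToPhysical A)
  transfer : HasUniqueLargestEigenvalue (transferMatrix A)

/-- The family is strong injective: after grouping finitely many neighbouring sites it is
generated by a strong injective tensor. -/
def IsStrongInjective {d : ℕ} (ρ : ChainFamily d) : Prop :=
  ∃ p : ℕ, 1 ≤ p ∧ ∃ (χ : ℕ) (A : LocalTensor (Fin p → Fin d) χ),
    IsStrongInjectiveTensor A ∧ GeneratedBy ρ p A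

/-- Linear maps on the operators of a finite-dimensional space with basis `κ`. -/
abbrev SuperOp (κ : Type) : Type := Matrix κ κ ℂ →ₗ[ℂ] Matrix κ κ ℂ

/-- Quantum channels, in Kraus form. -/
def IsQuantumChannel {κ : Type} [Fintype κ] [DecidableEq κ] (Φ : SuperOp κ) : Prop :=
  ∃ (m : ℕ) (K : Fin m → Matrix κ κ ℂ), ∑ a, (K a)ᴴ * K a = 1 ∧
    ∀ X, Φ X = ∑ a, K a * X * (K a)ᴴ

/-- Non-degenerate channels: injective on the whole operator space. -/
structure IsNondegenerateChannel {κ : Type} [Fintype κ] [DecidableEq κ] (Φ : SuperOp κ) :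
    Prop where
  channel : IsQuantumChannel Φ
  injective : Function.Injective Φ

/-- The configuration `i` with the entries at sites `x` and `y` replaced by `a`. -/
def setPair {d N : ℕ} (i : Fin N → Fin d) (x y : Fin N) (a : Fin d × Fin d) : Fin N → Fin d :=
  Function.update (Function.update i x a.1) y a.2

/-- `Φ ⊗ id`, where the two-site map `Φ` acts on the (distinct) sites `x`, `y` and the identity
acts on all other sites. -/
def onSites {d N : ℕ} (Φ : SuperOp (Fin d × Fin d)) (x y : Fin N) : SuperOp (Fin N → Fin d) where
  toFun X := Matrix.of fun i j =>
    Φ (Matrix.of fun a b => X (setPair i x y a) (setPair j x y b)) (i x, i y) (j x, j y)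
  map_add' X Y := by
    ext i j
    have h : (Matrix.of fun a b => (X + Y) (setPair i x y a) (setPair j x y b)) =
        (Matrix.of fun a b => X (setPair i x y a) (setPair j x y b)) +
          Matrix.of fun a b => Y (setPair i x y a) (setPair j x y b) := rfl
    rw [Matrix.of_apply, h, map_add]
    rfl
  map_smul' c X := by
    ext i j
    have h : (Matrix.of fun a b => (c • X) (setPair i x y a) (setPair j x y b)) =
        c • Matrix.of fun a b => X (setPair i x y a) (setPair j x y b) := rfl
    rw [Matrix.of_apply, h, map_smul]
    rfl

/-- First site of the `k`-th gate of layer `s`: `2k` in even layers, `2k + 1` in odd layers. -/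
def gateLeft {N : ℕ} (s : ℕ) (k : Fin (N / 2)) : Fin N :=
  ⟨2 * k.1 + s % 2, by have := k.2; omega⟩

/-- Second site of the `k`-th gate of layer `s`: the right neighbour on the ring. -/
def gateRight {N : ℕ} (s : ℕ) (k : Fin (N / 2)) : Fin N :=
  ⟨(2 * k.1 + s % 2 + 1) % N, Nat.mod_lt _ (by have := k.2; omega)⟩

/-- One layer of a brickwork circuit on a ring of `N` sites (`N` even): a product of maps acting
on disjoint pairs of neighbours. -/
def layer {d N : ℕ} (s : ℕ) (G : Fin (N / 2) → SuperOp (Fin d × Fin d)) :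
    Module.End ℂ (ChainOp (Fin d) N) :=
  (List.ofFn fun k => (onSites (G k) (gateLeft s k) (gateRight s k) :
    Module.End ℂ (ChainOp (Fin d) N))).prod

/-- The brickwork circuit with layers `0, …, t - 1`, layer `0` acting first. -/
def brickwork {d N : ℕ} (G : ℕ → Fin (N / 2) → SuperOp (Fin d × Fin d)) :
    ℕ → Module.End ℂ (ChainOp (Fin d) N)
  | 0 => 1
  | t + 1 => layer t (G t) * brickwork G t

/-- Brickwork circuits of depth `t` all of whose gates are non-degenerate channels. The gates may
vary from layer to layer and from place to place. -/
def IsNondegenerateBrickwork {d N : ℕ} (t : ℕ) (E : Module.End ℂ (ChainOp (Fin d) N)) : Prop :=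
  ∃ G : ℕ → Fin (N / 2) → SuperOp (Fin d × Fin d),
    (∀ s, s < t → ∀ k, IsNondegenerateChannel (G s k)) ∧ E = brickwork G t

end StrongInjectiveMPDO

end

namespace StrongInjectiveMPDO

open Matrix Module

/-! ### Spectra: power traces, nonzero eigenvalues and limits of powers. -/

section Spectra

open Polynomial

/-! The circuit enters through two facts. It preserves the trace, and its gates have
trace-preserving linear inverses, positive or not. Hence every statement about two distant regions
that is insensitive to gates not crossing their boundaries passes between the input and the output,
in both directions, once the regions are trimmed by `t` sites at each end. This relation
(`IsLinked`) is symmetric, so one implication suffices: if `ρ` is generated by an injective tensor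
`A` with unique largest eigenvalue, and `σ`, generated by some tensor `D`, is linked to `ρ`, then
`σ` is strong injective.

Equality of traces on all rings gives tr T_D^k = tr T_A^k, so the two transfer matrices have the
same nonzero spectrum and T_D has a unique largest eigenvalue. Splitting along invariant subspaces,
the traces of words in `D` are those of an irreducible tensor `B` carrying this eigenvalue plus
those of a remainder `C`. The tensor `B` becomes injective after blocking
(`eventually_tensorSpan_pow_eq_top`). What remains is to show that `C` contributes nothing on
suitable rings, and two local properties achieve this.

Schmidt rank: let a, b, c count the nonzero eigenvalues of T_A, T_B, T_C, so a = b + c. With all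
other sites traced out, two distant regions of `σ` have operator Schmidt rank at most b² + c²,
whereas for the injective `A` the rank is at least a². Hence bc = 0, and since b ≥ 1 the matrix T_C
is nilpotent.

Independence: for an injective tensor, a product of two distant functionals vanishes against
everything else only if one factor does. Since T_C is nilpotent and T_B is not, on large cells there
are functionals that see any prescribed part of `B` and nothing of `C`, and therefore also
functionals that see `C` and not `B`. The product of one of each kind annihilates `σ`, the first
factor alone does not, so the second does. This forces the operators of `C` to vanish, and `σ` is
generated by a blocking of `B`. -/

theorem trace_pow_restrict_maxGenEigenspace {V : Type*} [AddCommGroup V] [Module ℂ V]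
    [FiniteDimensional ℂ V] (f : Module.End ℂ V) (μ : ℂ) (k : ℕ)
    (h : Set.MapsTo (f ^ k) (f.maxGenEigenspace μ) (f.maxGenEigenspace μ)) :
    LinearMap.trace ℂ _ (LinearMap.restrict (f ^ k) h) =
      (finrank ℂ (f.maxGenEigenspace μ) : ℂ) * μ ^ k := by
  have hf := f.mapsTo_maxGenEigenspace_of_comm (Commute.refl f) μ
  set g : Module.End ℂ (f.maxGenEigenspace μ) := LinearMap.restrict f hf with hg
  have hgf : ∀ (n : ℕ) (w : f.maxGenEigenspace μ),
      (((g - μ • 1) ^ n) w : V) = ((f - μ • 1) ^ n) (w : V) := by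
    intro n
    induction n with
    | zero => intro w; rfl
    | succ n ih =>
      intro w
      rw [pow_succ, pow_succ, Module.End.mul_apply, Module.End.mul_apply, ih]
      rfl
  have hnil : IsNilpotent (g - μ • 1) := by
    refine ⟨finrank ℂ V, LinearMap.ext fun w => Subtype.ext ?_⟩
    have hw : (w : V) ∈ f.maxGenEigenspace μ := w.2
    generalize hx : (w : V) = x at hw
    rw [Module.End.maxGenEigenspace_eq_genEigenspace_finrank, Module.End.genEigenspace_nat] at hw
    rw [hgf, hx]
    exact hw
  have hpow : LinearMap.restrict (f ^ k) h = g ^ k := by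
    have hgp : ∀ (n : ℕ) (w : f.maxGenEigenspace μ), ((g ^ n) w : V) = (f ^ n) (w : V) := by
      intro n
      induction n with
      | zero => intro w; rfl
      | succ n ih =>
        intro w
        rw [pow_succ, pow_succ, Module.End.mul_apply, Module.End.mul_apply, ih]
        rfl
    exact LinearMap.ext fun w => Subtype.ext (hgp k w).symm
  have hcomm : Commute g (μ • 1) := by
    rw [← Algebra.algebraMap_eq_smul_one]
    exact (Algebra.commutes μ g).symm
  -- The difference is the nilpotent `g - μ` times a factor commuting with it, so its trace
  -- vanishes.
  have hnil2 : IsNilpotent (g ^ k - (μ • 1) ^ k) := by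
    rw [← hcomm.geom_sum₂_mul k]
    refine Commute.isNilpotent_mul_left ?_ hnil
    have h2 : Commute (g - μ • 1) g := (Commute.refl g).sub_left hcomm.symm
    have h3 : Commute (g - μ • 1) (μ • 1) := by
      rw [← Algebra.algebraMap_eq_smul_one]
      exact (Algebra.commutes μ _).symm
    exact (Commute.sum_right _ _ _ fun i _ => (h2.pow_right _).mul_right (h3.pow_right _)).symm
  have h0 := (LinearMap.isNilpotent_trace_of_isNilpotent hnil2).eq_zero
  rw [map_sub, sub_eq_zero] at h0
  rw [hpow, h0, _root_.smul_pow, one_pow, map_smul, LinearMap.trace_one, smul_eq_mul, mul_comm]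

theorem trace_pow_eq_sum_roots {n : ℕ} (T : Matrix (Fin n) (Fin n) ℂ) (k : ℕ) :
    (T ^ k).trace = (T.charpoly.roots.map (· ^ k)).sum := by
  classical
  set f : Module.End ℂ (Fin n → ℂ) := Matrix.toLin' T with hf
  have hint : DirectSum.IsInternal f.maxGenEigenspace :=
    (DirectSum.isInternal_submodule_iff_iSupIndep_and_iSup_eq_top _).2
      ⟨f.independent_maxGenEigenspace, f.iSup_maxGenEigenspace_eq_top⟩
  have hfin : {μ | f.maxGenEigenspace μ ≠ ⊥}.Finite :=
    WellFoundedGT.finite_ne_bot_of_iSupIndep f.independent_maxGenEigenspace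
  have hmaps : ∀ μ, Set.MapsTo (f ^ k) (f.maxGenEigenspace μ) (f.maxGenEigenspace μ) := fun μ =>
    f.mapsTo_maxGenEigenspace_of_comm ((Commute.refl f).pow_right k) μ
  have h1 := LinearMap.trace_eq_sum_trace_restrict' hint hfin hmaps
  have h2 : LinearMap.trace ℂ _ (f ^ k) = (T ^ k).trace := by
    rw [hf, ← Matrix.toLin'_pow, Matrix.trace_toLin'_eq]
  have hmem : ∀ μ, finrank ℂ (f.maxGenEigenspace μ) = T.charpoly.roots.count μ := by
    intro μ
    rw [LinearMap.finrank_maxGenEigenspace_eq, hf, Matrix.charpoly_toLin', count_roots]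
  rw [← h2, h1, Finset.sum_multiset_map_count]
  have h3 : hfin.toFinset = T.charpoly.roots.toFinset := by
    ext μ
    rw [Set.Finite.mem_toFinset, Multiset.mem_toFinset, ← Multiset.count_pos, ← hmem,
      Nat.pos_iff_ne_zero, ne_eq, Submodule.finrank_eq_zero]
    rfl
  rw [h3]
  refine Finset.sum_congr rfl fun μ _ => ?_
  rw [trace_pow_restrict_maxGenEigenspace, hmem, nsmul_eq_mul]

/-- Dedekind's independence of characters, applied to the characters n ↦ z^n of the additive monoid
ℕ. -/
theorem count_eq_of_sum_pow_eq {s t : Multiset ℂ}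
    (h : ∀ n : ℕ, 1 ≤ n → (s.map (· ^ n)).sum = (t.map (· ^ n)).sum) (a : ℂ) (ha : a ≠ 0) :
    s.count a = t.count a := by
  classical
  have key : LinearIndependent ℂ (fun z : ℂ => (powersHom ℂ z : Multiplicative ℕ → ℂ)) := by
    have := (linearIndependent_monoidHom (Multiplicative ℕ) ℂ).comp (powersHom ℂ)
      (powersHom ℂ).injective
    exact this
  have hs : ∀ (s : Multiset ℂ) (F : Finset ℂ), s.toFinset ⊆ F → ∀ n : ℕ,
      (s.map (· ^ n)).sum = ∑ z ∈ F, (s.count z : ℂ) * z ^ n := by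
    intro s F hF n
    rw [Finset.sum_multiset_map_count]
    simp only [nsmul_eq_mul]
    refine Finset.sum_subset hF fun z _ hz => ?_
    rw [Multiset.mem_toFinset, ← Multiset.count_eq_zero] at hz
    simp [hz]
  set F := insert a (s.toFinset ∪ t.toFinset) with hF
  -- Equality is known only for exponents at least 1, so one factor `z` goes into the coefficient;
  -- this is why multiplicities are recovered only at nonzero points.
  have h2 := linearIndependent_iff'.1 key F
    (fun z => ((s.count z : ℂ) - t.count z) * z) ?_ a (by simp [hF])
  · simpa [ha, sub_eq_zero] using h2
  · funext n
    have := h (n.toAdd + 1) (by omega)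
    rw [hs s F (by intro x; simp [hF]; tauto), hs t F (by intro x; simp [hF]; tauto), ← sub_eq_zero,
      ← Finset.sum_sub_distrib] at this
    simp only [Finset.sum_apply, Pi.smul_apply, smul_eq_mul, powersHom_apply, Pi.zero_apply]
    rw [← this]
    refine Finset.sum_congr rfl fun z _ => ?_
    ring

/-- The number of nonzero eigenvalues, counted with algebraic multiplicity. -/
noncomputable def nonzeroRootCount {n : ℕ} (T : Matrix (Fin n) (Fin n) ℂ) : ℕ :=
  (T.charpoly.roots.filter (· ≠ 0)).card

/-- From the exponent `n` on, the kernel of the power is the full generalized eigenspace at 0. -/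
theorem rank_pow_eq_nonzeroRootCount {n : ℕ} (T : Matrix (Fin n) (Fin n) ℂ) {m : ℕ} (hm : n ≤ m) :
    (T ^ m).rank = nonzeroRootCount T := by
  rw [nonzeroRootCount]
  classical
  have h1 : (T ^ m).rank + T.charpoly.roots.count 0 = n := by
    have h2 := LinearMap.finrank_range_add_finrank_ker ((Matrix.toLin' T) ^ m)
    have h3 : LinearMap.ker ((Matrix.toLin' T) ^ m) = Module.End.maxGenEigenspace (Matrix.toLin' T) 0 := by
      refine le_antisymm (fun v hv => ?_) (fun v hv => ?_)
      · exact (Module.End.mem_maxGenEigenspace _ _ _).2 ⟨m, by simpa using hv⟩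
      · rw [Module.End.maxGenEigenspace_eq_genEigenspace_finrank,
          Module.End.genEigenspace_nat, finrank_fin_fun, zero_smul, sub_zero] at hv
        rw [LinearMap.mem_ker] at hv ⊢
        rw [← Nat.sub_add_cancel hm, pow_add, Module.End.mul_apply, hv, map_zero]
    rw [h3, LinearMap.finrank_maxGenEigenspace_eq, ← Matrix.toLin'_pow,
      Matrix.charpoly_toLin', finrank_fin_fun] at h2
    rw [count_roots]
    exact h2
  have h2 : T.charpoly.roots.card = n := by
    rw [IsAlgClosed.card_roots_eq_natDegree, Matrix.charpoly_natDegree_eq_dim, Fintype.card_fin]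
  have h3 := Multiset.filter_add_not (· = (0 : ℂ)) T.charpoly.roots
  have h4 := congrArg Multiset.card h3
  rw [Multiset.card_add, Multiset.filter_eq', Multiset.card_replicate] at h4
  simp only [ne_eq]
  omega

theorem hasUniqueLargestEigenvalue_iff {n : ℕ} (T : Matrix (Fin n) (Fin n) ℂ) :
    HasUniqueLargestEigenvalue T ↔ ∃ r : ℝ, 0 < r ∧ T.charpoly.roots.count (r : ℂ) = 1 ∧
      ∀ z : ℂ, 0 < T.charpoly.roots.count z → z ≠ (r : ℂ) → ‖z‖ < r := by
  have h : ∀ z, 0 < T.charpoly.roots.count z ↔ T.charpoly.IsRoot z := fun z => by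
    rw [Multiset.count_pos, mem_roots (Matrix.charpoly_monic T).ne_zero]
  simp only [HasUniqueLargestEigenvalue, ← h, count_roots]

theorem HasUniqueLargestEigenvalue.of_count_eq {n m : ℕ} {T : Matrix (Fin n) (Fin n) ℂ}
    {S : Matrix (Fin m) (Fin m) ℂ} (hT : HasUniqueLargestEigenvalue T)
    (h : ∀ z : ℂ, z ≠ 0 → S.charpoly.roots.count z = T.charpoly.roots.count z) :
    HasUniqueLargestEigenvalue S := by
  rw [hasUniqueLargestEigenvalue_iff] at hT ⊢
  obtain ⟨r, hr, h1, h2⟩ := hT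
  refine ⟨r, hr, by rw [h _ (by exact_mod_cast hr.ne'), h1], fun z hz hzr => ?_⟩
  rcases eq_or_ne z 0 with rfl | h0
  · simpa using hr
  · exact h2 z (h z h0 ▸ hz) hzr

theorem count_roots_eq_of_trace_pow {n m : ℕ} {T : Matrix (Fin n) (Fin n) ℂ}
    {S : Matrix (Fin m) (Fin m) ℂ} (h : ∀ k, 1 ≤ k → (S ^ k).trace = (T ^ k).trace)
    (z : ℂ) (hz : z ≠ 0) : S.charpoly.roots.count z = T.charpoly.roots.count z :=
  count_eq_of_sum_pow_eq (fun k hk => by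
    rw [← trace_pow_eq_sum_roots, ← trace_pow_eq_sum_roots, h k hk]) z hz

theorem count_roots_eq_add_of_trace_pow {n m l : ℕ} {T : Matrix (Fin n) (Fin n) ℂ}
    {S : Matrix (Fin m) (Fin m) ℂ} {U : Matrix (Fin l) (Fin l) ℂ}
    (h : ∀ k, 1 ≤ k → (T ^ k).trace = (S ^ k).trace + (U ^ k).trace) (z : ℂ) (hz : z ≠ 0) :
    T.charpoly.roots.count z = S.charpoly.roots.count z + U.charpoly.roots.count z := by
  rw [← Multiset.count_add]
  refine count_eq_of_sum_pow_eq (fun k hk => ?_) z hz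
  rw [Multiset.map_add, Multiset.sum_add, ← trace_pow_eq_sum_roots, ← trace_pow_eq_sum_roots,
    ← trace_pow_eq_sum_roots, h k hk]

theorem nonzeroRootCount_eq_add_of_trace_pow {n m l : ℕ} {T : Matrix (Fin n) (Fin n) ℂ}
    {S : Matrix (Fin m) (Fin m) ℂ} {U : Matrix (Fin l) (Fin l) ℂ}
    (h : ∀ k, 1 ≤ k → (T ^ k).trace = (S ^ k).trace + (U ^ k).trace) :
    nonzeroRootCount T = nonzeroRootCount S + nonzeroRootCount U := by
  classical
  rw [nonzeroRootCount, nonzeroRootCount, nonzeroRootCount, ← Multiset.card_add,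
    ← Multiset.filter_add]
  congr 1
  ext z
  rcases eq_or_ne z 0 with rfl | hz
  · rw [Multiset.count_filter_of_neg (by simp), Multiset.count_filter_of_neg (by simp)]
  · rw [Multiset.count_filter_of_pos (p := (· ≠ (0 : ℂ))) hz,
      Multiset.count_filter_of_pos (p := (· ≠ (0 : ℂ))) hz, Multiset.count_add,
      count_roots_eq_add_of_trace_pow h z hz]

/-- Power sums identify the nonzero eigenvalues of the power with the `k`-th powers of eigenvalues;
strict domination in modulus excludes a second preimage of `r ^ k`. -/
theorem HasUniqueLargestEigenvalue.pow {n : ℕ} {T : Matrix (Fin n) (Fin n) ℂ}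
    (hT : HasUniqueLargestEigenvalue T) {k : ℕ} (hk : 1 ≤ k) :
    HasUniqueLargestEigenvalue (T ^ k) := by
  classical
  rw [hasUniqueLargestEigenvalue_iff] at hT ⊢
  obtain ⟨r, hr, h1, h2⟩ := hT
  have hcount : ∀ z : ℂ, z ≠ 0 → (T ^ k).charpoly.roots.count z =
      (T.charpoly.roots.map (· ^ k)).count z := by
    refine count_eq_of_sum_pow_eq fun j hj => ?_
    rw [← trace_pow_eq_sum_roots, Multiset.map_map, ← pow_mul, trace_pow_eq_sum_roots]
    simp only [Function.comp_def, pow_mul]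
  have hk0 : k ≠ 0 := by omega
  have hmem : ∀ z ∈ T.charpoly.roots, z ≠ (r : ℂ) → ‖z‖ < r := fun z hz => h2 z (Multiset.count_pos.2 hz)
  refine ⟨r ^ k, pow_pos hr k, ?_, fun z hz hzr => ?_⟩
  · have hrk : ((r ^ k : ℝ) : ℂ) ≠ 0 := by exact_mod_cast (pow_pos hr k).ne'
    rw [hcount _ hrk, Multiset.count_map, ← h1, Multiset.count_eq_card_filter_eq]
    congr 1
    refine Multiset.filter_congr fun z hz => ⟨fun h => ?_, fun h => by rw [← h]; push_cast; rfl⟩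
    by_contra hne
    have hlt := pow_lt_pow_left₀ (hmem z hz (Ne.symm hne)) (norm_nonneg z) hk0
    rw [← norm_pow, ← h, Complex.norm_real, Real.norm_of_nonneg (pow_pos hr k).le] at hlt
    exact lt_irrefl _ hlt
  · rcases eq_or_ne z 0 with rfl | h0
    · simpa using pow_pos hr k
    · rw [hcount z h0, Multiset.count_pos, Multiset.mem_map] at hz
      obtain ⟨w, hw, rfl⟩ := hz
      rw [norm_pow]
      refine pow_lt_pow_left₀ (hmem w hw ?_) (norm_nonneg w) hk0
      rintro rfl
      exact hzr (by push_cast; rfl)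

/-- The generalized eigenspace is the line through `R`. If L·R = 0, then `R` would lie in the kernel
of `L`, which by dimension is the range of T − r; a preimage of `R` would be a generalized
eigenvector off that line. -/
theorem exists_eigenvectors_of_count_roots_eq_one {n : ℕ} {T : Matrix (Fin n) (Fin n) ℂ} {r : ℂ}
    (h : T.charpoly.roots.count r = 1) :
    ∃ R L : Fin n → ℂ, T *ᵥ R = r • R ∧ L ᵥ* T = r • L ∧ L ⬝ᵥ R = 1 ∧
      ∀ v, T *ᵥ v = r • v → ∃ c : ℂ, v = c • R := by
  classical
  set f : Module.End ℂ (Fin n → ℂ) := Matrix.toLin' T with hf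
  have hdet : (T - scalar (Fin n) r).det = 0 := by
    have h1 : r ∈ T.charpoly.roots := Multiset.count_pos.1 (by omega)
    have h2 := (mem_roots (Matrix.charpoly_monic T).ne_zero).1 h1
    rw [IsRoot, Matrix.eval_charpoly, ← neg_sub, Matrix.det_neg] at h2
    simpa using h2
  have hmulVec : ∀ v, (T - scalar (Fin n) r) *ᵥ v = T *ᵥ v - r • v := fun v => by
    rw [Matrix.sub_mulVec]
    congr 1
    ext i
    simp [Matrix.scalar_apply, Matrix.mulVec_diagonal]
  have hvecMul : ∀ v, v ᵥ* (T - scalar (Fin n) r) = v ᵥ* T - r • v := fun v => by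
    rw [Matrix.vecMul_sub]
    congr 1
    ext i
    simp [Matrix.scalar_apply, Matrix.vecMul_diagonal, mul_comm]
  obtain ⟨R, hR0, hR⟩ := Matrix.exists_mulVec_eq_zero_iff.2 hdet
  obtain ⟨L, hL0, hL⟩ := Matrix.exists_vecMul_eq_zero_iff.2 hdet
  rw [hmulVec, sub_eq_zero] at hR
  have hL' := hL
  rw [hvecMul, sub_eq_zero] at hL'
  have hmem : ∀ (k : ℕ) v, ((f - r • 1) ^ k) v = 0 → v ∈ f.maxGenEigenspace r := fun k v hv =>
    (Module.End.mem_maxGenEigenspace _ _ _).2 ⟨k, hv⟩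
  have hsub : ∀ v, (f - r • 1) v = T *ᵥ v - r • v := fun v => by simp [hf]
  have hfin : finrank ℂ (f.maxGenEigenspace r) = 1 := by
    rw [LinearMap.finrank_maxGenEigenspace_eq, hf, Matrix.charpoly_toLin', ← count_roots, h]
  have hRmem : R ∈ f.maxGenEigenspace r := hmem 1 R (by rw [pow_one, hsub, hR, sub_self])
  have hspan : ∀ v ∈ f.maxGenEigenspace r, ∃ c : ℂ, v = c • R := by
    intro v hv
    obtain ⟨c, hc⟩ := (finrank_eq_one_iff_of_nonzero' (⟨R, hRmem⟩ : f.maxGenEigenspace r)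
      (by simpa [Subtype.ext_iff] using hR0)).1 hfin ⟨v, hv⟩
    exact ⟨c, by simpa [Subtype.ext_iff, eq_comm] using hc⟩
  have hker : ∀ v, T *ᵥ v = r • v → ∃ c : ℂ, v = c • R := fun v hv =>
    hspan v (hmem 1 v (by rw [pow_one, hsub, hv, sub_self]))
  have hLR : L ⬝ᵥ R ≠ 0 := by
    intro h0
    let φ : (Fin n → ℂ) →ₗ[ℂ] ℂ := LinearMap.toSpanSingleton ℂ ℂ 1 ∘ₗ dotProductBilin ℂ ℂ L
    have hφ : ∀ v, φ v = L ⬝ᵥ v := fun v => by simp [φ]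
    have hφ0 : φ ≠ 0 := fun h1 => hL0 (by
      ext i
      have := hφ (Pi.single i 1)
      simpa [h1, eq_comm] using this)
    have hle : LinearMap.range (f - r • 1) ≤ LinearMap.ker φ := by
      rintro _ ⟨v, rfl⟩
      rw [LinearMap.mem_ker, hφ, hsub, ← hmulVec, Matrix.dotProduct_mulVec, hL, zero_dotProduct]
    have hker1 : finrank ℂ (LinearMap.ker (f - r • 1)) ≤ 1 := by
      rw [← hfin]
      exact Submodule.finrank_mono fun v hv => hmem 1 v (by simpa using hv)
    have hd1 := LinearMap.finrank_range_add_finrank_ker (f - r • 1)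
    have hd2 := Module.Dual.finrank_ker_add_one_of_ne_zero hφ0
    have heq := Submodule.eq_of_le_of_finrank_le hle (by omega)
    have hRr : R ∈ LinearMap.range (f - r • 1) := by
      rw [heq, LinearMap.mem_ker, hφ, h0]
    obtain ⟨u, hu⟩ := hRr
    obtain ⟨c, rfl⟩ := hspan u (hmem 2 u (by
      rw [pow_two, Module.End.mul_apply, hu, hsub, hR, sub_self]))
    rw [map_smul, hsub, hR, sub_self, smul_zero] at hu
    exact hR0 hu.symm
  refine ⟨R, (L ⬝ᵥ R)⁻¹ • L, hR, ?_, ?_, hker⟩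
  · rw [Matrix.smul_vecMul, hL', smul_comm]
  · rw [smul_dotProduct, smul_eq_mul, inv_mul_cancel₀ hLR]

/-- Rank factorization. The factors bound Schmidt ranks from above; the one-sided inverses,
compressing `S` to an identity matrix, bound them from below. -/
theorem exists_mul_eq_rank {n : ℕ} (S : Matrix (Fin n) (Fin n) ℂ) :
    ∃ (W : Matrix (Fin n) (Fin S.rank) ℂ) (U : Matrix (Fin S.rank) (Fin n) ℂ)
      (W' : Matrix (Fin S.rank) (Fin n) ℂ) (U' : Matrix (Fin n) (Fin S.rank) ℂ),
      S = W * U ∧ W' * S * U' = 1 := by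
  have hr : finrank ℂ (LinearMap.range S.mulVecLin) = S.rank := rfl
  let e : LinearMap.range S.mulVecLin ≃ₗ[ℂ] (Fin S.rank → ℂ) :=
    LinearEquiv.ofFinrankEq _ _ (by rw [hr, finrank_fin_fun])
  let u : (Fin n → ℂ) →ₗ[ℂ] (Fin S.rank → ℂ) := e.toLinearMap ∘ₗ S.mulVecLin.rangeRestrict
  let w : (Fin S.rank → ℂ) →ₗ[ℂ] (Fin n → ℂ) :=
    (LinearMap.range S.mulVecLin).subtype ∘ₗ e.symm.toLinearMap
  obtain ⟨u', hu'⟩ := LinearMap.exists_rightInverse_of_surjective u (by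
    rw [LinearMap.range_eq_top]
    exact e.surjective.comp S.mulVecLin.surjective_rangeRestrict)
  obtain ⟨w', hw'⟩ := LinearMap.exists_leftInverse_of_injective w (by
    rw [LinearMap.ker_eq_bot]
    exact Subtype.val_injective.comp e.symm.injective)
  have hS : S = LinearMap.toMatrix' w * LinearMap.toMatrix' u := by
    rw [← LinearMap.toMatrix'_comp]
    have : w ∘ₗ u = Matrix.toLin' S := by
      ext v : 2
      simp [w, u]
    rw [this, LinearMap.toMatrix'_toLin']
  refine ⟨_, _, LinearMap.toMatrix' w', LinearMap.toMatrix' u', hS, ?_⟩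
  refine (congrArg (fun X => LinearMap.toMatrix' w' * X * LinearMap.toMatrix' u') hS).trans ?_
  rw [← LinearMap.toMatrix'_comp, ← LinearMap.toMatrix'_comp, ← LinearMap.toMatrix'_comp,
    ← LinearMap.comp_assoc, hw', LinearMap.id_comp, hu', LinearMap.toMatrix'_id]

section Limit

attribute [local instance] Matrix.linftyOpNormedRing Matrix.linftyOpNormedAlgebra

/-- Gelfand's formula: the spectral radius is below 1, so the norms of the powers eventually decay
geometrically. -/
theorem tendsto_pow_zero_of_norm_eigenvalue_lt_one {n : ℕ} {M : Matrix (Fin n) (Fin n) ℂ}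
    (h : ∀ z : ℂ, ∀ v : Fin n → ℂ, v ≠ 0 → M *ᵥ v = z • v → ‖z‖ < 1) :
    Filter.Tendsto (fun k : ℕ => M ^ k) Filter.atTop (nhds 0) := by
  rcases isEmpty_or_nonempty (Fin n) with hn | hn
  · simp only [Subsingleton.elim _ (0 : Matrix (Fin n) (Fin n) ℂ)]
    exact tendsto_const_nhds
  have hspec : spectralRadius ℂ M < (1 : NNReal) := by
    refine spectrum.spectralRadius_lt_of_forall_lt M fun z hz => ?_
    rw [← Matrix.spectrum_toLin'] at hz
    obtain ⟨v, hv⟩ := (Module.End.hasEigenvalue_iff_mem_spectrum.2 hz).exists_hasEigenvector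
    have := h z v hv.2 (by simpa using hv.apply_eq_smul)
    exact_mod_cast this
  obtain ⟨ρ, h1, h2⟩ := ENNReal.lt_iff_exists_nnreal_btwn.1 hspec
  have hev := (spectrum.pow_nnnorm_pow_one_div_tendsto_nhds_spectralRadius M).eventually_lt_const h1
  have hρ : ρ < 1 := by exact_mod_cast h2
  refine tendsto_zero_iff_norm_tendsto_zero.2 ?_
  refine squeeze_zero' (Filter.Eventually.of_forall fun k => norm_nonneg _) ?_
    (tendsto_pow_atTop_nhds_zero_of_lt_one ρ.2 (by exact_mod_cast hρ))
  filter_upwards [hev, Filter.eventually_gt_atTop 0] with k hk hk0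
  have hk' : (k : ℝ) ≠ 0 := by exact_mod_cast hk0.ne'
  have h3 := ENNReal.rpow_le_rpow hk.le (Nat.cast_nonneg (α := ℝ) k)
  rw [← ENNReal.rpow_mul, one_div, inv_mul_cancel₀ hk', ENNReal.rpow_one, ENNReal.rpow_natCast] at h3
  exact_mod_cast h3

end Limit

/-- With S = T / r and spectral projection E = R Lᵀ, one has S^k = E + (S − E)^k, and S − E has only
eigenvalues of modulus below 1. -/
theorem tendsto_pow_of_hasUniqueLargest {n : ℕ} {T : Matrix (Fin n) (Fin n) ℂ} {r : ℝ} (hr : 0 < r)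
    {R L : Fin n → ℂ} (hR : T *ᵥ R = (r : ℂ) • R) (hL : L ᵥ* T = (r : ℂ) • L) (hLR : L ⬝ᵥ R = 1)
    (hker : ∀ v, T *ᵥ v = (r : ℂ) • v → ∃ c : ℂ, v = c • R)
    (hlt : ∀ z : ℂ, 0 < T.charpoly.roots.count z → z ≠ (r : ℂ) → ‖z‖ < r) :
    Filter.Tendsto (fun k : ℕ => ((r : ℂ)⁻¹ • T) ^ k) Filter.atTop (nhds (vecMulVec R L)) := by
  have hr0 : (r : ℂ) ≠ 0 := by exact_mod_cast hr.ne'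
  set S := (r : ℂ)⁻¹ • T with hS
  set E := vecMulVec R L with hE
  have hSE : S * E = E := by
    rw [hS, hE, Matrix.smul_mul, Matrix.mul_vecMulVec, hR, smul_vecMulVec, smul_smul,
      inv_mul_cancel₀ hr0, one_smul]
  have hES : E * S = E := by
    rw [hS, hE, Matrix.mul_smul, Matrix.vecMulVec_mul, hL, vecMulVec_smul, smul_smul,
      inv_mul_cancel₀ hr0, one_smul]
  have hEE : E * E = E := by
    rw [hE, Matrix.vecMulVec_mul_vecMulVec, hLR, one_smul]
  have hpow : ∀ k : ℕ, 1 ≤ k → S ^ k = E + (S - E) ^ k := by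
    intro k hk
    induction k, hk using Nat.le_induction with
    | base => simp
    | succ k hk ih =>
      have h1 : E * (S - E) = 0 := by rw [mul_sub, hES, hEE, sub_self]
      have h2 : (S - E) ^ k * E = 0 := by
        obtain ⟨j, rfl⟩ := Nat.exists_eq_add_of_le' hk
        rw [pow_succ, mul_assoc, sub_mul, hSE, hEE, sub_self, mul_zero]
      calc S ^ (k + 1) = (E + (S - E) ^ k) * ((S - E) + E) := by rw [pow_succ, ih, sub_add_cancel]
        _ = E + (S - E) ^ (k + 1) := by
          rw [mul_add, add_mul, add_mul, h1, h2, hEE, pow_succ]; abel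
  have hzero : Filter.Tendsto (fun k : ℕ => (S - E) ^ k) Filter.atTop (nhds 0) := by
    refine tendsto_pow_zero_of_norm_eigenvalue_lt_one fun z v hv hzv => ?_
    rcases eq_or_ne z 0 with rfl | hz
    · simp
    -- E(S − E) = 0, so an eigenvector of S − E with nonzero eigenvalue is killed by `E` and is an
    -- eigenvector of `T`; its eigenvalue is not `r`, since `E` fixes `R`.
    have hEv : E *ᵥ v = 0 := by
      have h1 : E *ᵥ ((S - E) *ᵥ v) = 0 := by
        rw [Matrix.mulVec_mulVec, mul_sub, hES, hEE, sub_self, Matrix.zero_mulVec]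
      rw [hzv, Matrix.mulVec_smul] at h1
      exact (smul_eq_zero.1 h1).resolve_left hz
    have hTv : T *ᵥ v = ((r : ℂ) * z) • v := by
      rw [Matrix.sub_mulVec, hEv, sub_zero, hS, Matrix.smul_mulVec] at hzv
      rw [mul_smul, ← hzv, smul_smul, mul_inv_cancel₀ hr0, one_smul]
    have hne : (r : ℂ) * z ≠ r := by
      intro h1
      rw [h1] at hTv
      obtain ⟨c, rfl⟩ := hker v hTv
      have hER : E *ᵥ R = R := by
        rw [hE, Matrix.vecMulVec_mulVec, hLR]
        simp
      rw [Matrix.mulVec_smul, hER] at hEv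
      exact hv hEv
    have hroot : 0 < T.charpoly.roots.count ((r : ℂ) * z) := by
      rw [Multiset.count_pos, mem_roots (Matrix.charpoly_monic T).ne_zero,
        ← Matrix.mem_spectrum_iff_isRoot_charpoly, ← Matrix.spectrum_toLin']
      exact (Module.End.hasEigenvalue_of_hasEigenvector (x := v)
        ⟨Module.End.mem_eigenspace_iff.2 (by simpa using hTv), hv⟩).mem_spectrum
    have := hlt _ hroot hne
    rw [norm_mul, Complex.norm_real, Real.norm_of_nonneg hr.le] at this
    nlinarith [norm_nonneg z]
  have hlim := (tendsto_const_nhds (x := E)).add hzero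
  rw [add_zero] at hlim
  refine hlim.congr' ?_
  filter_upwards [Filter.eventually_ge_atTop 1] with k hk
  exact (hpow k hk).symm

end Spectra

/-! ### Tensors: invariant subspaces, irreducible components, blocking to injectivity. -/

section Tensors

open Polynomial

variable {σ : Type} {χ : ℕ}

/-- The matrix product of a word of (ket, bra) letters. -/
def wordProd (A : LocalTensor σ χ) (w : List (σ × σ)) : Matrix (Fin χ) (Fin χ) ℂ :=
  (w.map fun s => A s.1 s.2).prod

/-- The span of the matrices of a tensor. -/
def tensorSpan (A : LocalTensor σ χ) : Submodule ℂ (Matrix (Fin χ) (Fin χ) ℂ) :=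
  Submodule.span ℂ (Set.range fun s : σ × σ => A s.1 s.2)

/-- The matrices of a tensor contracted with a coefficient function. -/
def contract [Fintype σ] (A : LocalTensor σ χ) (a : σ × σ → ℂ) : Matrix (Fin χ) (Fin χ) ℂ :=
  ∑ s, a s • A s.1 s.2

/-- The coefficient function of the trace. -/
def traceCoeff (σ : Type) [DecidableEq σ] (s : σ × σ) : ℂ := if s.1 = s.2 then 1 else 0

theorem transferMatrix_eq_contract [Fintype σ] [DecidableEq σ] (A : LocalTensor σ χ) :
    transferMatrix A = contract A (traceCoeff σ) := by
  rw [contract, Fintype.sum_prod_type]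
  simp [transferMatrix, traceCoeff]

theorem transferMatrix_mem_tensorSpan [Fintype σ] (A : LocalTensor σ χ) :
    transferMatrix A ∈ tensorSpan A :=
  Submodule.sum_mem _ fun i _ => Submodule.subset_span ⟨(i, i), rfl⟩

theorem prod_ofFn_contract [Fintype σ] (A : LocalTensor σ χ) {n : ℕ} (a : Fin n → σ × σ → ℂ) :
    (List.ofFn fun x => contract A (a x)).prod =
      ∑ W : Fin n → σ × σ, (∏ x, a x (W x)) • wordProd A (List.ofFn W) := by
  have h := (MultilinearMap.mkPiAlgebraFin ℂ n (Matrix (Fin χ) (Fin χ) ℂ)).map_sum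
    (fun x (s : σ × σ) => a x s • A s.1 s.2)
  simp only [MultilinearMap.map_smul_univ, MultilinearMap.mkPiAlgebraFin_apply] at h
  rw [show (List.ofFn fun x => contract A (a x)).prod = _ from h]
  refine Finset.sum_congr rfl fun W _ => ?_
  rw [wordProd, List.map_ofFn]
  rfl

/-- The trace of every word for `A` is the sum of the traces for `B` and `C`. -/
def TraceSplits {v u : ℕ} (A : LocalTensor σ χ) (B : LocalTensor σ v) (C : LocalTensor σ u) :
    Prop :=
  ∀ w, (wordProd A w).trace = (wordProd B w).trace + (wordProd C w).trace

theorem TraceSplits.trace_prod_contract [Fintype σ] {v u : ℕ} {A : LocalTensor σ χ}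
    {B : LocalTensor σ v} {C : LocalTensor σ u} (h : TraceSplits A B C) {n : ℕ}
    (a : Fin n → σ × σ → ℂ) :
    (List.ofFn fun x => contract A (a x)).prod.trace =
      (List.ofFn fun x => contract B (a x)).prod.trace +
        (List.ofFn fun x => contract C (a x)).prod.trace := by
  simp only [prod_ofFn_contract, Matrix.trace_sum, Matrix.trace_smul, h _, smul_add,
    Finset.sum_add_distrib]

theorem TraceSplits.trace_transfer_pow [Fintype σ] {v u : ℕ} {A : LocalTensor σ χ}
    {B : LocalTensor σ v} {C : LocalTensor σ u} (h : TraceSplits A B C) (k : ℕ) :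
    (transferMatrix A ^ k).trace = (transferMatrix B ^ k).trace + (transferMatrix C ^ k).trace := by
  classical
  have := h.trace_prod_contract fun _ : Fin k => traceCoeff σ
  simpa [← transferMatrix_eq_contract, List.ofFn_const, List.prod_replicate] using this

/-- No proper nonzero subspace is invariant under all the matrices of the tensor. -/
def IsIrreducibleTensor (A : LocalTensor σ χ) : Prop :=
  ∀ W : Submodule ℂ (Fin χ → ℂ), (∀ i j, ∀ v ∈ W, A i j *ᵥ v ∈ W) → W = ⊥ ∨ W = ⊤

theorem trace_fromBlocks_eq {v u : ℕ} (P : Matrix (Fin v) (Fin v) ℂ) (Q : Matrix (Fin v) (Fin u) ℂ)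
    (P' : Matrix (Fin u) (Fin v) ℂ) (Q' : Matrix (Fin u) (Fin u) ℂ) :
    (fromBlocks P Q P' Q').trace = P.trace + Q'.trace := by
  simp [Matrix.trace, Fintype.sum_sum_type]

/-- In a basis adapted to an invariant subspace every word is block upper triangular, and its trace
sees only the diagonal blocks. -/
theorem traceSplits_of_basis {v u : ℕ} (A : LocalTensor σ χ)
    (b : Basis (Fin v ⊕ Fin u) ℂ (Fin χ → ℂ))
    (hb : ∀ i j k l, b.repr (A i j *ᵥ b (Sum.inl k)) (Sum.inr l) = 0) :
    ∃ (B : LocalTensor σ v) (C : LocalTensor σ u), TraceSplits A B C := by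
  let M := fun X : Matrix (Fin χ) (Fin χ) ℂ => LinearMap.toMatrix b b (Matrix.toLin' X)
  have hM : ∀ X, M X = LinearMap.toMatrix b b (Matrix.toLin' X) := fun _ => rfl
  refine ⟨fun i j => (M (A i j)).toBlocks₁₁, fun i j => (M (A i j)).toBlocks₂₂, fun w => ?_⟩
  have key : ∃ X, M (wordProd A w) = fromBlocks (wordProd (fun i j => (M (A i j)).toBlocks₁₁) w) X 0
      (wordProd (fun i j => (M (A i j)).toBlocks₂₂) w) := by
    induction w with
    | nil =>
      refine ⟨0, ?_⟩
      simp [wordProd, hM, ← Matrix.fromBlocks_one]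
    | cons s w ih =>
      obtain ⟨X, hX⟩ := ih
      have h0 : (M (A s.1 s.2)).toBlocks₂₁ = 0 := by
        ext l k
        simpa [Matrix.toBlocks₂₁, hM, LinearMap.toMatrix_apply] using hb s.1 s.2 k l
      have h1 : M (wordProd A (s :: w)) = M (A s.1 s.2) * M (wordProd A w) := by
        rw [hM, hM, hM, ← LinearMap.toMatrix_mul, wordProd, List.map_cons, List.prod_cons,
          Matrix.toLin'_mul]
        rfl
      rw [h1, hX, ← Matrix.fromBlocks_toBlocks (M (A s.1 s.2)), h0, Matrix.fromBlocks_multiply]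
      simp only [wordProd, List.map_cons, List.prod_cons, Matrix.zero_mul, Matrix.mul_zero,
        add_zero, zero_add]
      exact ⟨_, rfl⟩
  obtain ⟨X, hX⟩ := key
  rw [← Matrix.trace_toLin'_eq, LinearMap.trace_eq_matrix_trace ℂ b, ← hM, hX,
    trace_fromBlocks_eq]

theorem exists_traceSplits_of_invariant (A : LocalTensor σ χ) (W : Submodule ℂ (Fin χ → ℂ))
    (hW : ∀ i j, ∀ v ∈ W, A i j *ᵥ v ∈ W) (h0 : W ≠ ⊥) (h1 : W ≠ ⊤) :
    ∃ (v u : ℕ) (B : LocalTensor σ v) (C : LocalTensor σ u), v < χ ∧ u < χ ∧ TraceSplits A B C := by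
  have hd := W.finrank_quotient_add_finrank
  have hp : 0 < finrank ℂ W := Nat.pos_of_ne_zero fun h => h0 (Submodule.finrank_eq_zero.1 h)
  have hl := Submodule.finrank_lt h1
  rw [finrank_fin_fun] at hd hl
  obtain ⟨B, C, h⟩ := traceSplits_of_basis A
    (Basis.sumQuot (finBasis ℂ W) (finBasis ℂ ((Fin χ → ℂ) ⧸ W))) (fun i j k l => by
      rw [Basis.sumQuot_repr_inr, Basis.sumQuot_inl]
      have : W.mkQ (A i j *ᵥ (finBasis ℂ W k : Fin χ → ℂ)) = 0 := by
        rw [← LinearMap.mem_ker, Submodule.ker_mkQ]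
        exact hW i j _ (Submodule.coe_mem _)
      simp [this])
  exact ⟨_, _, B, C, hl, by omega, h⟩

theorem exists_directSum {v u : ℕ} (B : LocalTensor σ v) (C : LocalTensor σ u) :
    ∃ D : LocalTensor σ (v + u), TraceSplits D B C := by
  refine ⟨fun i j => reindexAlgEquiv ℂ ℂ finSumFinEquiv (fromBlocks (B i j) 0 0 (C i j)),
    fun w => ?_⟩
  have key : wordProd (fun i j => reindexAlgEquiv ℂ ℂ finSumFinEquiv
      (fromBlocks (B i j) 0 0 (C i j))) w =
      reindexAlgEquiv ℂ ℂ finSumFinEquiv (fromBlocks (wordProd B w) 0 0 (wordProd C w)) := by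
    induction w with
    | nil => simp [wordProd]
    | cons s w ih =>
      simp only [wordProd, List.map_cons, List.prod_cons] at ih ⊢
      rw [ih, ← map_mul, Matrix.fromBlocks_multiply]
      simp
  rw [key, ← trace_fromBlocks_eq _ 0 0, Matrix.trace, Matrix.trace]
  exact finSumFinEquiv.symm.sum_comp fun x =>
    (fromBlocks (wordProd B w) 0 0 (wordProd C w)) x x

/-- Take a summand carrying `r` of least bond dimension. An invariant subspace would split it, one
piece would still carry `r`, and the other could be moved into the remainder. -/
theorem exists_irreducible_component [Fintype σ] (A : LocalTensor σ χ) {r : ℂ} (hr : r ≠ 0)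
    (hroot : 0 < (transferMatrix A).charpoly.roots.count r) :
    ∃ (v u : ℕ) (B : LocalTensor σ v) (C : LocalTensor σ u), TraceSplits A B C ∧
      IsIrreducibleTensor B ∧ 0 < (transferMatrix B).charpoly.roots.count r := by
  classical
  let P : ℕ → Prop := fun v => ∃ (u : ℕ) (B : LocalTensor σ v) (C : LocalTensor σ u),
    TraceSplits A B C ∧ 0 < (transferMatrix B).charpoly.roots.count r
  have hP : ∃ v, P v := ⟨χ, 0, A, fun _ _ => 0, fun w => by simp [Matrix.trace], hroot⟩
  obtain ⟨u, B, C, hs, hB⟩ := Nat.find_spec hP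
  refine ⟨_, u, B, C, hs, fun W hW => ?_, hB⟩
  by_contra! hne
  obtain ⟨v₁, v₂, B₁, B₂, h1, h2, h12⟩ := exists_traceSplits_of_invariant B W hW hne.1 hne.2
  rw [count_roots_eq_add_of_trace_pow (fun k _ => h12.trace_transfer_pow k) r hr] at hB
  rcases Nat.eq_zero_or_pos ((transferMatrix B₁).charpoly.roots.count r) with h0 | h0
  · obtain ⟨D, hD⟩ := exists_directSum B₁ C
    exact Nat.find_min hP h2 ⟨_, B₂, D, fun w => by rw [hs, h12, hD]; ring, by omega⟩
  · obtain ⟨D, hD⟩ := exists_directSum B₂ C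
    exact Nat.find_min hP h1 ⟨_, B₁, D, fun w => by rw [hs, h12, hD]; ring, h0⟩

section EventuallySpan

attribute [local instance] Matrix.linftyOpNormedAddCommGroup Matrix.linftyOpNormedSpace

/-- Linear independence of a finite family is an open condition, and n² independent matrices span.
-/
theorem span_eq_top_of_tendsto_single {n : ℕ}
    (F : ℕ → Fin n × Fin n → Matrix (Fin n) (Fin n) ℂ)
    (hF : ∀ p, Filter.Tendsto (fun k => F k p) Filter.atTop (nhds (Matrix.single p.1 p.2 1))) :
    ∀ᶠ k in Filter.atTop, Submodule.span ℂ (Set.range (F k)) = ⊤ := by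
  have hlin : LinearIndependent ℂ fun p : Fin n × Fin n =>
      (Matrix.single p.1 p.2 1 : Matrix (Fin n) (Fin n) ℂ) := by
    have := (Matrix.stdBasis ℂ (Fin n) (Fin n)).linearIndependent
    convert this using 1
    ext p : 1
    rw [Matrix.stdBasis_eq_single]
  have h := (tendsto_pi_nhds.2 hF).eventually hlin.eventually
  filter_upwards [h] with k hk
  exact hk.span_eq_top_of_card_eq_finrank' (by simp [Module.finrank_matrix])

end EventuallySpan

/-- Irreducibility lets words of a fixed length send `R` to any vector, and words of another fixed
length send `L` to any row vector. Placing many copies of T / r, which tends to R Lᵀ, between such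
words approximates every matrix unit. -/
theorem eventually_tensorSpan_pow_eq_top [Fintype σ] {A : LocalTensor σ χ}
    (hA : IsIrreducibleTensor A) (hT : HasUniqueLargestEigenvalue (transferMatrix A)) :
    ∃ l : ℕ, ∀ k, l ≤ k → tensorSpan A ^ k = ⊤ := by
  obtain ⟨r, hr, h1, h2⟩ := (hasUniqueLargestEigenvalue_iff _).1 hT
  have hr0 : (r : ℂ) ≠ 0 := by exact_mod_cast hr.ne'
  obtain ⟨R, L, hR, hL, hLR, hker⟩ := exists_eigenvectors_of_count_roots_eq_one h1
  have hlim := tendsto_pow_of_hasUniqueLargest hr hR hL hLR hker h2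
  set T := transferMatrix A with hTdef
  have hTS : T ∈ tensorSpan A := transferMatrix_mem_tensorSpan A
  have hAS : ∀ i j, A i j ∈ tensorSpan A := fun i j => Submodule.subset_span ⟨(i, j), rfl⟩
  let ρ : Matrix (Fin χ) (Fin χ) ℂ →ₗ[ℂ] (Fin χ → ℂ) :=
    { toFun := fun M => M *ᵥ R
      map_add' := fun M N => Matrix.add_mulVec M N R
      map_smul' := fun c M => Matrix.smul_mulVec c M R }
  let lam : Matrix (Fin χ) (Fin χ) ℂ →ₗ[ℂ] (Fin χ → ℂ) :=
    { toFun := fun M => L ᵥ* M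
      map_add' := fun M N => Matrix.vecMul_add M N L
      map_smul' := fun c M => Matrix.vecMul_smul L c M }
  -- As `R` is an eigenvector, a word can be lengthened by `T` without changing its value on `R` up
  -- to the scalar `r`. The increasing chain stabilizes at an invariant subspace containing `R`.
  have hρmono : Monotone fun k : ℕ => (tensorSpan A ^ k).map ρ := by
    refine monotone_nat_of_le_succ fun k => ?_
    rintro _ ⟨M, hM, rfl⟩
    refine ⟨(r : ℂ)⁻¹ • (M * T), Submodule.smul_mem _ _ ?_, ?_⟩
    · rw [pow_succ]
      exact Submodule.mul_mem_mul hM hTS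
    · change ((r : ℂ)⁻¹ • (M * T)) *ᵥ R = M *ᵥ R
      rw [Matrix.smul_mulVec, ← Matrix.mulVec_mulVec, hR, Matrix.mulVec_smul, smul_smul,
        inv_mul_cancel₀ hr0, one_smul]
  have hlmono : Monotone fun k : ℕ => (tensorSpan A ^ k).map lam := by
    refine monotone_nat_of_le_succ fun k => ?_
    rintro _ ⟨M, hM, rfl⟩
    refine ⟨(r : ℂ)⁻¹ • (T * M), Submodule.smul_mem _ _ ?_, ?_⟩
    · rw [pow_succ']
      exact Submodule.mul_mem_mul hTS hM
    · change L ᵥ* ((r : ℂ)⁻¹ • (T * M)) = L ᵥ* M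
      rw [Matrix.vecMul_smul, ← Matrix.vecMul_vecMul, hL, Matrix.smul_vecMul, smul_smul,
        inv_mul_cancel₀ hr0, one_smul]
  obtain ⟨a, ha⟩ := monotone_stabilizes_iff_noetherian.2 inferInstance ⟨_, hρmono⟩
  obtain ⟨b, hb⟩ := monotone_stabilizes_iff_noetherian.2 inferInstance ⟨_, hlmono⟩
  have ha1 : (tensorSpan A ^ a).map ρ = (tensorSpan A ^ (a + 1)).map ρ := ha (a + 1) (by omega)
  have hb1 : (tensorSpan A ^ b).map lam = (tensorSpan A ^ (b + 1)).map lam := hb (b + 1) (by omega)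
  have hRmem : R ∈ (tensorSpan A ^ a).map ρ := hρmono (Nat.zero_le a)
    ⟨1, by rw [pow_zero]; exact Submodule.one_le.1 le_rfl, Matrix.one_mulVec R⟩
  have hLmem : L ∈ (tensorSpan A ^ b).map lam := hlmono (Nat.zero_le b)
    ⟨1, by rw [pow_zero]; exact Submodule.one_le.1 le_rfl, Matrix.vecMul_one L⟩
  have hatop : (tensorSpan A ^ a).map ρ = ⊤ := by
    refine (hA _ ?_).resolve_left fun h => ?_
    · rintro i j _ ⟨M, hM, rfl⟩
      rw [ha1, pow_succ']
      exact ⟨A i j * M, Submodule.mul_mem_mul (hAS i j) hM, (Matrix.mulVec_mulVec R _ _).symm⟩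
    · rw [h, Submodule.mem_bot] at hRmem
      simp [hRmem] at hLR
  have hbtop : (tensorSpan A ^ b).map lam = ⊤ := by
    -- Irreducibility concerns column vectors, so it is applied to the annihilator of the row space
    -- reached from `L`.
    let K : Submodule ℂ (Fin χ → ℂ) :=
      { carrier := {v | ∀ l ∈ (tensorSpan A ^ b).map lam, l ⬝ᵥ v = 0}
        add_mem' := fun {v w} hv hw l hl => by rw [dotProduct_add, hv l hl, hw l hl, add_zero]
        zero_mem' := fun l _ => dotProduct_zero l
        smul_mem' := fun c v hv l hl => by rw [dotProduct_smul, hv l hl, smul_zero] }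
    have hK : K = ⊥ := by
      refine (hA K ?_).resolve_right fun h => ?_
      · intro i j v hv l hl
        rw [Matrix.dotProduct_mulVec]
        refine hv _ ?_
        obtain ⟨M, hM, rfl⟩ := hl
        rw [hb1, pow_succ]
        exact ⟨M * A i j, Submodule.mul_mem_mul hM (hAS i j), (Matrix.vecMul_vecMul L _ _).symm⟩
      · have : R ∈ K := h ▸ Submodule.mem_top
        rw [this L hLmem] at hLR
        exact zero_ne_one hLR
    by_contra hne
    obtain ⟨f, hf, hle⟩ := Submodule.exists_le_ker_of_lt_top _ (lt_top_iff_ne_top.2 hne)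
    have hfv : ∀ l, f l = l ⬝ᵥ fun i => f (Pi.single i 1) := fun l => by
      conv_lhs => rw [pi_eq_sum_univ' l]
      simp [dotProduct]
    have : (fun i => f (Pi.single i 1)) ∈ K := fun l hl => by rw [← hfv]; exact hle hl
    rw [hK, Submodule.mem_bot] at this
    exact hf (LinearMap.ext fun l => by rw [hfv, this, dotProduct_zero]; rfl)
  have hM : ∀ i : Fin χ, ∃ M ∈ tensorSpan A ^ a, M *ᵥ R = Pi.single i 1 := fun i => by
    have : (Pi.single i 1 : Fin χ → ℂ) ∈ (tensorSpan A ^ a).map ρ := hatop ▸ Submodule.mem_top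
    exact this
  have hN : ∀ i : Fin χ, ∃ N ∈ tensorSpan A ^ b, L ᵥ* N = Pi.single i 1 := fun i => by
    have : (Pi.single i 1 : Fin χ → ℂ) ∈ (tensorSpan A ^ b).map lam := hbtop ▸ Submodule.mem_top
    exact this
  choose M hM hMR using hM
  choose N hN hNL using hN
  have hev := span_eq_top_of_tendsto_single
    (fun k p => M p.1 * ((r : ℂ)⁻¹ • T) ^ k * N p.2) (fun p => by
      have := (hlim.const_mul (M p.1)).mul_const (N p.2)
      rw [Matrix.mul_vecMulVec, Matrix.vecMulVec_mul, hMR, hNL] at this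
      rwa [← Matrix.single_eq_single_vecMulVec_single] at this)
  obtain ⟨l, hl⟩ := Filter.eventually_atTop.1 hev
  -- `a` letters reach columns from `R`, `b` letters reach rows from `L`, and at least `l` copies of
  -- `T` stand between.
  refine ⟨a + l + b, fun k hk => ?_⟩
  rw [eq_top_iff, ← hl (k - a - b) (by omega), Submodule.span_le]
  rintro _ ⟨p, rfl⟩
  have hk' : k = a + (k - a - b) + b := by omega
  have hpow : tensorSpan A ^ k = tensorSpan A ^ a * tensorSpan A ^ (k - a - b) * tensorSpan A ^ b := by
    rw [← pow_add, ← pow_add, ← hk']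
  rw [hpow]
  refine Submodule.mul_mem_mul (Submodule.mul_mem_mul (hM _) ?_) (hN _)
  exact Submodule.pow_mem_pow _ (Submodule.smul_mem _ _ hTS) _

end Tensors

/-! ### Cells: regrouping sites and evaluating functionals cell by cell. -/

section Cells

variable {α : Type} {n k p N d χ v u : ℕ}

/-- A configuration of `n * p` sites as a configuration of `n` cells of `p` sites. -/
def cells (h : n * p = N) : (Fin N → α) ≃ (Fin n → Fin p → α) :=
  (Equiv.arrowCongr (finProdFinEquiv.trans (finCongr h)).symm (Equiv.refl α)).trans
    (Equiv.curry (Fin n) (Fin p) α)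

theorem cells_apply (h : n * p = N) (i : Fin N → α) (x : Fin n) (y : Fin p) :
    cells h i x y = i (Fin.cast h (finProdFinEquiv (x, y))) := rfl

/-- A pair of configurations as a word of pairs of cell configurations. -/
def pairCells (h : n * p = N) :
    (Fin N → α) × (Fin N → α) ≃ (Fin n → (Fin p → α) × (Fin p → α)) :=
  ((cells h).prodCongr (cells h)).trans (Equiv.arrowProdEquivProdArrow _ _ _).symm

theorem pairCells_apply (h : n * p = N) (i j : Fin N → α) (x : Fin n) :
    pairCells h (i, j) x = (cells h i x, cells h j x) := rfl

/-- The translationally invariant operator generated by a tensor on a ring of `n` cells. -/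
def ringOp (h : n * p = N) (A : LocalTensor (Fin p → Fin d) χ) : ChainOp (Fin d) N :=
  Matrix.of fun i j => (wordProd A (List.ofFn (pairCells h (i, j)))).trace

/-- With the ring length as a free variable, one ring can be cut into cells of several sizes without
casts between types. -/
theorem generatedBy_iff {ρ : ChainFamily d} {A : LocalTensor (Fin p → Fin d) χ} :
    GeneratedBy ρ p A ↔ ∀ n N (h : n * p = N), 1 ≤ n → ρ N = ringOp h A := by
  have hmp : ∀ n i j, mpdo A n i j = (wordProd A (List.ofFn fun x => (i x, j x))).trace :=
    fun n i j => by simp [mpdo, wordProd, List.map_ofFn, Function.comp_def]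
  constructor
  · rintro hg n N rfl hn
    ext i j
    have h1 := congrFun (congrFun (hg n hn) (cells rfl i)) (cells rfl j)
    rw [hmp] at h1
    rw [ringOp, Matrix.of_apply]
    refine Eq.trans ?_ h1
    simp only [grouped, Matrix.of_apply, cells_apply, Prod.mk.eta, Equiv.apply_symm_apply,
      Fin.cast_eq_self]
  · intro hg n hn
    ext i j
    rw [hmp, grouped, Matrix.of_apply, hg n _ rfl hn, ringOp, Matrix.of_apply]
    congr 3
    ext x : 1
    rw [pairCells_apply]
    congr 1 <;> funext y <;> simp only [cells_apply, Fin.cast_eq_self, Equiv.symm_apply_apply]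

/-- The tensor obtained by grouping `k` cells into one. -/
def blockTensor (k : ℕ) (A : LocalTensor (Fin p → α) χ) : LocalTensor (Fin (k * p) → α) χ :=
  fun i j => wordProd A (List.ofFn (pairCells rfl (i, j)))

theorem wordProd_blockTensor (A : LocalTensor (Fin p → α) χ)
    (w : List ((Fin (k * p) → α) × (Fin (k * p) → α))) :
    wordProd (blockTensor k A) w = wordProd A (w.flatMap fun s => List.ofFn (pairCells rfl s)) := by
  induction w with
  | nil => rfl
  | cons s w ih =>
    simp only [wordProd, List.map_cons, List.prod_cons, List.flatMap_cons, List.map_append,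
      List.prod_append] at ih ⊢
    rw [ih]
    rfl

theorem TraceSplits.blockTensor {A : LocalTensor (Fin p → α) χ} {B : LocalTensor (Fin p → α) v}
    {C : LocalTensor (Fin p → α) u} (h : TraceSplits A B C) (k : ℕ) :
    TraceSplits (blockTensor k A) (blockTensor k B) (blockTensor k C) := fun w => by
  rw [wordProd_blockTensor, wordProd_blockTensor, wordProd_blockTensor, h]

theorem ringOp_blockTensor (h : n * (k * p) = N) (h' : n * k * p = N)
    (A : LocalTensor (Fin p → Fin d) χ) : ringOp h (blockTensor k A) = ringOp h' A := by
  ext i j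
  rw [ringOp, ringOp, Matrix.of_apply, Matrix.of_apply, wordProd_blockTensor]
  congr 2
  rw [List.ofFn_mul, ← List.flatMap_id, List.flatMap_def, List.flatMap_def, List.map_ofFn,
    List.map_id]
  congr 2
  funext x
  simp only [Function.comp_apply]
  congr 1
  funext y
  rw [pairCells_apply, pairCells_apply, pairCells_apply]
  have key : ∀ l : Fin N → Fin d, cells rfl (cells h l x) y = cells h' l ⟨x * k + y, by
      calc (x : ℕ) * k + y < (x + 1) * k :=
            (Nat.add_lt_add_left y.prop _).trans_eq (by rw [Nat.add_mul, Nat.one_mul])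
        _ ≤ _ := Nat.mul_le_mul_right _ x.prop⟩ := by
    intro l
    funext z
    simp only [cells_apply]
    congr 1
    ext
    simp only [Fin.val_cast, finProdFinEquiv_apply_val]
    ring
  rw [key, key]

theorem GeneratedBy.blockTensor {ρ : ChainFamily d} {A : LocalTensor (Fin p → Fin d) χ}
    (hg : GeneratedBy ρ p A) (hk : 1 ≤ k) : GeneratedBy ρ (k * p) (blockTensor k A) := by
  rw [generatedBy_iff] at hg ⊢
  intro n N h hn
  rw [ringOp_blockTensor h (by rw [mul_assoc, h])]
  exact hg _ _ _ (Nat.mul_pos hn hk)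

/-- The product of coefficient functions on the cells. -/
def prodCoeff (a : Fin k → (Fin p → α) × (Fin p → α) → ℂ)
    (s : (Fin (k * p) → α) × (Fin (k * p) → α)) : ℂ :=
  ∏ y, a y (pairCells rfl s y)

theorem contract_blockTensor [Fintype α] (A : LocalTensor (Fin p → α) χ)
    (a : Fin k → (Fin p → α) × (Fin p → α) → ℂ) :
    contract (blockTensor k A) (prodCoeff a) = (List.ofFn fun y => contract A (a y)).prod := by
  classical
  rw [prod_ofFn_contract, contract, ← (pairCells rfl).sum_comp]
  rfl

theorem traceCoeff_eq_prod [DecidableEq α] (h : n * p = N) (i j : Fin N → α) :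
    traceCoeff (Fin N → α) (i, j) = ∏ x, traceCoeff (Fin p → α) (pairCells h (i, j) x) := by
  by_cases hij : i = j
  · subst hij
    simp [traceCoeff, pairCells_apply]
  · obtain ⟨x, hx⟩ := Function.ne_iff.1 fun h1 => hij ((cells h).injective h1)
    rw [Finset.prod_eq_zero (Finset.mem_univ x) (if_neg hx)]
    exact if_neg hij

theorem transferMatrix_blockTensor [Fintype α] [DecidableEq α] (A : LocalTensor (Fin p → α) χ) :
    transferMatrix (blockTensor k A) = transferMatrix A ^ k := by
  have : traceCoeff (Fin (k * p) → α) = prodCoeff fun _ => traceCoeff (Fin p → α) := by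
    funext s
    exact traceCoeff_eq_prod rfl s.1 s.2
  rw [transferMatrix_eq_contract, this, contract_blockTensor, List.ofFn_const, List.prod_replicate,
    transferMatrix_eq_contract]

theorem tensorSpan_blockTensor (A : LocalTensor (Fin p → α) χ) :
    tensorSpan (blockTensor k A) = tensorSpan A ^ k := by
  rw [tensorSpan, tensorSpan, Submodule.span_pow]
  congr 1
  ext M
  rw [Set.mem_pow]
  constructor
  · rintro ⟨s, rfl⟩
    refine ⟨fun y => ⟨_, pairCells rfl s y, rfl⟩, ?_⟩
    simp [blockTensor, wordProd, List.map_ofFn, Function.comp_def]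
  · rintro ⟨f, rfl⟩
    choose W hW using fun y => (f y).2
    refine ⟨(pairCells rfl).symm W, ?_⟩
    simp [blockTensor, wordProd, List.map_ofFn, Function.comp_def, hW]

theorem exists_contract_eq [Fintype α] {A : LocalTensor α χ} (h : tensorSpan A = ⊤)
    (M : Matrix (Fin χ) (Fin χ) ℂ) : ∃ a, contract A a = M := by
  have : M ∈ tensorSpan A := h ▸ Submodule.mem_top
  exact (Submodule.mem_span_range_iff_exists_fun ℂ).1 this

/-- The kernel of the map is the annihilator of the span of the matrices under the nondegenerate
pairing tr(M Xᵀ). -/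
theorem injective_virtualToPhysical_iff (A : LocalTensor α χ) :
    Function.Injective (virtualToPhysical A) ↔ tensorSpan A = ⊤ := by
  have hbil : ∀ (M X : Matrix (Fin χ) (Fin χ) ℂ),
      ∑ a, ∑ b, M a b * X a b = (M * Xᵀ).trace := fun M X => by
    simp [Matrix.trace, Matrix.mul_apply]
  constructor
  · intro hA
    by_contra hne
    obtain ⟨f, hf, hle⟩ := Submodule.exists_le_ker_of_lt_top _ (lt_top_iff_ne_top.2 hne)
    let X : Matrix (Fin χ) (Fin χ) ℂ := Matrix.of fun a b => f (Matrix.single a b 1)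
    have hfX : ∀ M, f M = ∑ a, ∑ b, M a b * X a b := fun M => by
      conv_lhs => rw [Matrix.matrix_eq_sum_single M]
      simp only [map_sum]
      refine Finset.sum_congr rfl fun a _ => Finset.sum_congr rfl fun b _ => ?_
      rw [← mul_one (M a b), ← smul_eq_mul, ← Matrix.smul_single, map_smul]
      simp [X]
    have hX : X = 0 := hA (by
      ext i j
      have h1 : f (A i j) = 0 := hle (Submodule.subset_span ⟨(i, j), rfl⟩)
      simp only [virtualToPhysical, Matrix.of_apply]
      rw [← hfX, h1]
      simp)
    exact hf (LinearMap.ext fun M => by simp [hfX, hX])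
  · intro h X Y hXY
    rw [← sub_eq_zero]
    have hz : ∀ M ∈ tensorSpan A, (M * (X - Y)ᵀ).trace = 0 := by
      intro M hM
      induction hM using Submodule.span_induction with
      | mem M hM =>
        obtain ⟨s, rfl⟩ := hM
        have := congrFun (congrFun hXY s.1) s.2
        simp only [virtualToPhysical, Matrix.of_apply, hbil] at this
        rw [Matrix.transpose_sub, mul_sub, Matrix.trace_sub, this, sub_self]
      | zero => simp
      | add M N _ _ h1 h2 => rw [add_mul, Matrix.trace_add, h1, h2, add_zero]
      | smul c M _ h1 => rw [Matrix.smul_mul, Matrix.trace_smul, h1, smul_zero]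
    ext a b
    have := hz (Matrix.single a b 1) (h ▸ Submodule.mem_top)
    rw [← hbil] at this
    simpa [Matrix.single_apply, ite_and] using this

/-- The bilinear pairing of two operators through their matrix entries. -/
def pairing {ι : Type} [Fintype ι] (f X : Matrix ι ι ℂ) : ℂ := ∑ i, ∑ j, f i j * X i j

/-- The sites of a ring from `lo` up to and excluding `hi`. -/
def segment (N lo hi : ℕ) : Set (Fin N) := {s | lo ≤ s.1 ∧ s.1 < hi}

/-- The matrix entries depend only on the configurations on the sites of `b`. -/
def LocalOn (b : Set (Fin N)) (f : ChainOp α N) : Prop :=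
  ∀ i i' j j', (∀ s ∈ b, i s = i' s) → (∀ s ∈ b, j s = j' s) → f i j = f i' j'

/-- A coefficient function on one cell as a function of the configurations of the ring. -/
def onCell (h : n * p = N) (x : Fin n) (a : (Fin p → α) × (Fin p → α) → ℂ) : ChainOp α N :=
  Matrix.of fun i j => a (pairCells h (i, j) x)

theorem cells_eq_iff (h : n * p = N) (i i' : Fin N → α) (x : Fin n) :
    cells h i x = cells h i' x ↔ ∀ s ∈ segment N (x * p) ((x + 1) * p), i s = i' s := by
  constructor
  · rintro he s ⟨h1, h2⟩
    rw [add_mul, one_mul] at h2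
    have := congrFun he ⟨s.1 - x * p, by omega⟩
    have hs : Fin.cast h (finProdFinEquiv (x, (⟨s.1 - x * p, by omega⟩ : Fin p))) = s := by
      ext
      simp only [Fin.val_cast, finProdFinEquiv_apply_val]
      rw [mul_comm p]
      omega
    rwa [cells_apply, cells_apply, hs] at this
  · intro he
    funext y
    have hval : (Fin.cast h (finProdFinEquiv (x, y))).1 = y + x * p := by
      rw [Fin.val_cast, finProdFinEquiv_apply_val, mul_comm p]
    exact he (Fin.cast h (finProdFinEquiv (x, y))) ⟨by omega, by rw [add_mul, one_mul]; omega⟩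

theorem localOn_onCell (h : n * p = N) (x : Fin n) (a : (Fin p → α) × (Fin p → α) → ℂ) :
    LocalOn (segment N (x * p) ((x + 1) * p)) (onCell h x a) := by
  intro i i' j j' hi hj
  simp only [onCell, Matrix.of_apply, pairCells_apply]
  rw [(cells_eq_iff h i i' x).2 hi, (cells_eq_iff h j j' x).2 hj]

/-- The coefficient function of an operator that is local on a cell. -/
def cellCoeff (h : n * p = N) :
    ChainOp (Fin d) N →ₗ[ℂ] ((Fin p → Fin d) × (Fin p → Fin d) → ℂ) where
  toFun f s := f ((cells h).symm fun _ => s.1) ((cells h).symm fun _ => s.2)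
  map_add' _ _ := rfl
  map_smul' _ _ := rfl

theorem LocalOn.eq_onCell (h : n * p = N) {x : Fin n} {f : ChainOp (Fin d) N}
    (hf : LocalOn (segment N (x * p) ((x + 1) * p)) f) : f = onCell h x (cellCoeff h f) := by
  ext i j
  refine hf _ _ _ _ ?_ ?_ <;> rw [← cells_eq_iff h] <;> simp [pairCells_apply]

theorem pairing_ringOp (h : n * p = N) (A : LocalTensor (Fin p → Fin d) χ)
    (f : ChainOp (Fin d) N) (F : (Fin n → (Fin p → Fin d) × (Fin p → Fin d)) → ℂ)
    (hf : ∀ i j, f i j = F (pairCells h (i, j))) :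
    pairing f (ringOp h A) = ∑ W, F W * (wordProd A (List.ofFn W)).trace := by
  rw [pairing, ← Fintype.sum_prod_type', ← (pairCells h).sum_comp]
  refine Finset.sum_congr rfl fun s _ => ?_
  rw [hf]
  rfl

theorem pairing_prod_ringOp (h : n * p = N) (A : LocalTensor (Fin p → Fin d) χ)
    (f : ChainOp (Fin d) N) (a : Fin n → (Fin p → Fin d) × (Fin p → Fin d) → ℂ)
    (hf : ∀ i j, f i j = ∏ x, a x (pairCells h (i, j) x)) :
    pairing f (ringOp h A) = (List.ofFn fun x => contract A (a x)).prod.trace := by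
  rw [pairing_ringOp h A f (fun W => ∏ x, a x (W x)) hf, prod_ofFn_contract, Matrix.trace_sum]
  simp

theorem sum_eq_zero_of_sum_update_eq_zero {ι β : Type} [Fintype ι] [DecidableEq ι] [Fintype β]
    (F : (ι → β) → ℂ) (x : ι) (hF : ∀ W, ∑ s, F (Function.update W x s) = 0) : ∑ W, F W = 0 := by
  classical
  rw [← (Equiv.funSplitAt x β).symm.sum_comp, Fintype.sum_prod_type_right]
  refine Finset.sum_eq_zero fun rest _ => ?_
  rcases isEmpty_or_nonempty β with hβ | ⟨⟨s₀⟩⟩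
  · simp
  · rw [← hF ((Equiv.funSplitAt x β).symm (s₀, rest))]
    refine Finset.sum_congr rfl fun s _ => congrArg F ?_
    funext y
    by_cases hy : y = x
    · subst hy; simp
    · simp [hy]

/-- Sum over cell `x` first: `g` is constant there and the word is linear in its `x`-th letter,
which is replaced by the vanishing contraction. -/
theorem pairing_ringOp_eq_zero (h : n * p = N) (A : LocalTensor (Fin p → Fin d) χ) (x : Fin n)
    (a : (Fin p → Fin d) × (Fin p → Fin d) → ℂ) (ha : contract A a = 0) (g : ChainOp (Fin d) N)
    (hg : LocalOn (segment N (x * p) ((x + 1) * p))ᶜ g) :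
    pairing (onCell h x a ⊙ g) (ringOp h A) = 0 := by
  classical
  let G : (Fin n → (Fin p → Fin d) × (Fin p → Fin d)) → ℂ := fun W =>
    g ((pairCells h).symm W).1 ((pairCells h).symm W).2
  rw [pairing_ringOp h A _ (fun W => a (W x) * G W) (fun i j => by simp [onCell, G])]
  refine sum_eq_zero_of_sum_update_eq_zero _ x fun W => ?_
  have hG : ∀ s, G (Function.update W x s) = G W := by
    intro s
    have key : ∀ i i' : Fin N → Fin d, (∀ y, y ≠ x → cells h i y = cells h i' y) →
        ∀ s ∈ (segment N (x * p) ((x + 1) * p))ᶜ, i s = i' s := by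
      intro i i' hii s hs
      obtain ⟨⟨y, z⟩, hyz⟩ := (finProdFinEquiv.trans (finCongr h)).surjective s
      have hyx : y ≠ x := by
        rintro rfl
        refine hs ⟨?_, ?_⟩ <;>
          simp only [← hyz, Equiv.trans_apply, finCongr_apply, Fin.val_cast,
            finProdFinEquiv_apply_val, mul_comm p]
        · omega
        · rw [add_mul, one_mul]
          omega
      have := congrFun (hii y hyx) z
      rw [cells_apply, cells_apply] at this
      rw [← hyz]
      exact this
    refine hg _ _ _ _ (key _ _ fun y hy => ?_) (key _ _ fun y hy => ?_)
    · exact congrArg Prod.fst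
        (show pairCells h ((pairCells h).symm (Function.update W x s)) y =
          pairCells h ((pairCells h).symm W) y by simp [hy])
    · exact congrArg Prod.snd
        (show pairCells h ((pairCells h).symm (Function.update W x s)) y =
          pairCells h ((pairCells h).symm W) y by simp [hy])
  have hlin : ∑ s, a s • wordProd A (List.ofFn (Function.update W x s)) = 0 := by
    let m := MultilinearMap.mkPiAlgebraFin ℂ n (Matrix (Fin χ) (Fin χ) ℂ)
    have hm : ∀ s, wordProd A (List.ofFn (Function.update W x s)) =
        m (Function.update (fun y => A (W y).1 (W y).2) x (A s.1 s.2)) := by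
      intro s
      rw [MultilinearMap.mkPiAlgebraFin_apply, wordProd, List.map_ofFn]
      congr 2
      funext y
      by_cases hy : y = x
      · subst hy; simp
      · simp [hy]
    simp only [hm, ← MultilinearMap.map_update_smul, ← MultilinearMap.map_update_sum]
    rw [show ∑ s, a s • A s.1 s.2 = 0 from ha]
    exact m.map_update_zero _ _
  have := congrArg (fun M => G W * Matrix.trace M) hlin
  simp only [Matrix.trace_sum, Matrix.trace_smul, Matrix.trace_zero, mul_zero, Finset.mul_sum] at this
  rw [← this]
  refine Finset.sum_congr rfl fun s _ => ?_
  simp only [Function.update_self, hG, smul_eq_mul]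
  ring

end Cells

/-! ### Superoperators acting on functionals. -/

section Transpose

variable {κ : Type} [Fintype κ]

theorem pairing_add_left (f g X : Matrix κ κ ℂ) : pairing (f + g) X = pairing f X + pairing g X := by
  simp [pairing, add_mul, Finset.sum_add_distrib]

theorem pairing_sum_left {ι : Type} (s : Finset ι) (f : ι → Matrix κ κ ℂ) (X : Matrix κ κ ℂ) :
    pairing (∑ k ∈ s, f k) X = ∑ k ∈ s, pairing (f k) X := by
  classical
  induction s using Finset.induction_on with
  | empty => simp [pairing]
  | insert k s hk ih => rw [Finset.sum_insert hk, Finset.sum_insert hk, pairing_add_left, ih]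

/-- Invertible trace-preserving maps. -/
structure IsReversible (Φ : SuperOp κ) : Prop where
  trace_eq : ∀ X, (Φ X).trace = X.trace
  bijective : Function.Bijective Φ

/-- The inverse of a channel need not be a channel; trace preservation and bijectivity, unlike
positivity, always pass to the inverse. -/
theorem IsReversible.exists_inverse {Φ : SuperOp κ} (h : IsReversible Φ) :
    ∃ Ψ : SuperOp κ, IsReversible Ψ ∧ Ψ ∘ₗ Φ = LinearMap.id ∧ Φ ∘ₗ Ψ = LinearMap.id := by
  let e := LinearEquiv.ofBijective Φ h.bijective
  have h1 : ∀ X, e.symm (Φ X) = X := e.symm_apply_apply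
  have h2 : ∀ X, Φ (e.symm X) = X := e.apply_symm_apply
  exact ⟨e.symm.toLinearMap, ⟨fun X => by rw [← h.trace_eq]; exact congrArg _ (h2 X),
    e.symm.bijective⟩, LinearMap.ext h1, LinearMap.ext h2⟩

variable [DecidableEq κ]

/-- The transpose of a superoperator with respect to the bilinear pairing. -/
def transposeOp (Φ : SuperOp κ) : SuperOp κ where
  toFun Y := Matrix.of fun a b => pairing Y (Φ (Matrix.single a b 1))
  map_add' Y Z := by
    ext a b
    exact pairing_add_left _ _ _
  map_smul' c Y := by
    ext a b
    simp [pairing, Finset.mul_sum, mul_assoc]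

theorem superOp_apply_eq_sum (Φ : SuperOp κ) (X : Matrix κ κ ℂ) (p q : κ) :
    Φ X p q = ∑ a, ∑ b, X a b * Φ (Matrix.single a b 1) p q := by
  conv_lhs => rw [Matrix.matrix_eq_sum_single X]
  simp only [map_sum, Matrix.sum_apply]
  refine Finset.sum_congr rfl fun a _ => Finset.sum_congr rfl fun b _ => ?_
  rw [← mul_one (X a b), ← smul_eq_mul, ← Matrix.smul_single, map_smul]
  simp

theorem pairing_transposeOp (Φ : SuperOp κ) (Y X : Matrix κ κ ℂ) :
    pairing (transposeOp Φ Y) X = pairing Y (Φ X) := by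
  have h : ∀ f Z : Matrix κ κ ℂ, pairing f Z = ∑ z : κ × κ, f z.1 z.2 * Z z.1 z.2 := fun f Z => by
    rw [pairing, Fintype.sum_prod_type]
  have hΦ : ∀ w : κ × κ, Φ X w.1 w.2 =
      ∑ z : κ × κ, X z.1 z.2 * Φ (Matrix.single z.1 z.2 1) w.1 w.2 := fun w => by
    rw [superOp_apply_eq_sum, Fintype.sum_prod_type]
  have hY : ∀ z : κ × κ, transposeOp Φ Y z.1 z.2 =
      ∑ w : κ × κ, Y w.1 w.2 * Φ (Matrix.single z.1 z.2 1) w.1 w.2 := fun z => h _ _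
  rw [h, h]
  simp only [hΦ, hY, Finset.sum_mul, Finset.mul_sum]
  rw [Finset.sum_comm]
  refine Finset.sum_congr rfl fun w _ => Finset.sum_congr rfl fun z _ => ?_
  ring

theorem transposeOp_transposeOp_of_comp_eq_id {Φ Ψ : SuperOp κ} (h : Ψ ∘ₗ Φ = LinearMap.id)
    (Y : Matrix κ κ ℂ) : transposeOp Φ (transposeOp Ψ Y) = Y := by
  ext a b
  change pairing (transposeOp Ψ Y) (Φ (Matrix.single a b 1)) = _
  rw [pairing_transposeOp, show Ψ (Φ (Matrix.single a b 1)) = _ from LinearMap.congr_fun h _]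
  simp [pairing, Matrix.single_apply, ite_and]

theorem IsNondegenerateChannel.isReversible {Φ : SuperOp κ} (h : IsNondegenerateChannel Φ) :
    IsReversible Φ := by
  refine ⟨fun X => ?_, h.injective, LinearMap.injective_iff_surjective.1 h.injective⟩
  obtain ⟨m, K, hK, hX⟩ := h.channel
  calc (Φ X).trace = ∑ a, ((K a)ᴴ * K a * X).trace := by
        rw [hX, Matrix.trace_sum]
        exact Finset.sum_congr rfl fun a _ => Matrix.trace_mul_cycle _ _ _
    _ = X.trace := by rw [← Matrix.trace_sum, ← Finset.sum_mul, hK, one_mul]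

/-- Trace preservation in dual form: the identity matrix represents the trace functional. -/
theorem IsReversible.transposeOp_one {Φ : SuperOp κ} (h : IsReversible Φ) :
    transposeOp Φ 1 = 1 := by
  have h1 : ∀ X : Matrix κ κ ℂ, pairing 1 X = X.trace := fun X => by
    simp [pairing, Matrix.one_apply, Matrix.trace]
  ext a b
  change pairing 1 (Φ (Matrix.single a b 1)) = _
  rw [h1, h.trace_eq, ← h1, pairing]
  simp [Matrix.single_apply, ite_and, Matrix.one_apply]

end Transpose

/-! ### Two-site gates acting on operators and local functionals. -/

section Gates

variable {d N : ℕ}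

theorem setPair_left {x y : Fin N} (hxy : x ≠ y) (i : Fin N → Fin d) (a : Fin d × Fin d) :
    setPair i x y a x = a.1 := by simp [setPair, hxy]

theorem setPair_right (x y : Fin N) (i : Fin N → Fin d) (a : Fin d × Fin d) :
    setPair i x y a y = a.2 := by simp [setPair]

theorem setPair_of_ne {x y s : Fin N} (h1 : s ≠ x) (h2 : s ≠ y) (i : Fin N → Fin d)
    (a : Fin d × Fin d) : setPair i x y a s = i s := by simp [setPair, h1, h2]

theorem setPair_setPair {x y : Fin N} (hxy : x ≠ y) (i : Fin N → Fin d) (a b : Fin d × Fin d) :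
    setPair (setPair i x y a) x y b = setPair i x y b := by
  funext s
  by_cases h2 : s = y
  · subst h2; simp only [setPair_right]
  by_cases h1 : s = x
  · subst h1; simp only [setPair_left hxy]
  · simp only [setPair_of_ne h1 h2]

theorem setPair_self {x y : Fin N} (hxy : x ≠ y) (i : Fin N → Fin d) :
    setPair i x y (i x, i y) = i := by
  funext s
  by_cases h2 : s = y
  · subst h2; simp only [setPair_right]
  by_cases h1 : s = x
  · subst h1; simp only [setPair_left hxy]
  · simp only [setPair_of_ne h1 h2]

theorem setPair_congr {x y : Fin N} {b : Set (Fin N)} {i i' : Fin N → Fin d}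
    (h : ∀ s ∈ b, i s = i' s) (a : Fin d × Fin d) :
    ∀ s ∈ b, setPair i x y a s = setPair i' x y a s := by
  intro s hs
  simp only [setPair, Function.update_apply, h s hs]

theorem onSites_apply (Φ : SuperOp (Fin d × Fin d)) (x y : Fin N) (X : ChainOp (Fin d) N)
    (i j : Fin N → Fin d) : onSites Φ x y X i j =
      Φ (Matrix.of fun a b => X (setPair i x y a) (setPair j x y b)) (i x, i y) (j x, j y) := rfl

/-- Exchanging the entries at two sites of a configuration with a given pair. -/
def swapPair {x y : Fin N} (hxy : x ≠ y) :
    Equiv.Perm ((Fin N → Fin d) × (Fin d × Fin d)) :=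
  Function.Involutive.toPerm (fun z => (setPair z.1 x y z.2, (z.1 x, z.1 y))) fun z => by
    simp only [setPair_setPair hxy, setPair_self hxy, setPair_left hxy, setPair_right]

theorem swapPair_apply {x y : Fin N} (hxy : x ≠ y) (i : Fin N → Fin d) (a : Fin d × Fin d) :
    swapPair hxy (i, a) = (setPair i x y a, (i x, i y)) := rfl

/-- Passage to the Heisenberg picture. Both sides are sums over configurations together with a
replacement pair, matched by the involution that exchanges the pair with the entries at `x` and `y`.
-/
theorem pairing_onSites (Φ : SuperOp (Fin d × Fin d)) {x y : Fin N} (hxy : x ≠ y)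
    (f X : ChainOp (Fin d) N) :
    pairing f (onSites Φ x y X) = pairing (onSites (transposeOp Φ) x y f) X := by
  let F : (Fin N → Fin d) × (Fin d × Fin d) → (Fin N → Fin d) × (Fin d × Fin d) → ℂ := fun z w =>
    f z.1 w.1 * (X (setPair z.1 x y z.2) (setPair w.1 x y w.2) *
      Φ (Matrix.single z.2 w.2 1) (z.1 x, z.1 y) (w.1 x, w.1 y))
  have h1 : pairing f (onSites Φ x y X) = ∑ z, ∑ w, F z w := by
    simp only [Fintype.sum_prod_type (f := fun z : (Fin N → Fin d) × (Fin d × Fin d) => ∑ w, F z w)]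
    rw [pairing]
    refine Finset.sum_congr rfl fun i _ => ?_
    simp only [Fintype.sum_prod_type (f := F _)]
    rw [Finset.sum_comm]
    refine Finset.sum_congr rfl fun j _ => ?_
    rw [onSites_apply, superOp_apply_eq_sum, Finset.mul_sum]
    simp only [Finset.mul_sum]
    rfl
  have h2 : pairing (onSites (transposeOp Φ) x y f) X = ∑ z, ∑ w, F (swapPair hxy z)
      (swapPair hxy w) := by
    rw [Fintype.sum_prod_type, pairing]
    refine Finset.sum_congr rfl fun i _ => ?_
    simp only [Fintype.sum_prod_type (f := fun w => F _ (swapPair hxy w))]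
    rw [Finset.sum_comm]
    refine Finset.sum_congr rfl fun j _ => ?_
    rw [onSites_apply]
    simp only [F, swapPair_apply, setPair_setPair hxy, setPair_self hxy, setPair_left hxy,
      setPair_right, transposeOp, LinearMap.coe_mk, AddHom.coe_mk, Matrix.of_apply, pairing,
      Finset.sum_mul]
    refine Finset.sum_congr rfl fun a _ => Finset.sum_congr rfl fun b _ => ?_
    simp only [Prod.mk.eta]
    ring
  rw [h1, h2, Equiv.sum_comp (swapPair hxy) fun z => ∑ w, F z (swapPair hxy w)]
  exact Finset.sum_congr rfl fun z _ => (Equiv.sum_comp (swapPair hxy) (F z)).symm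

theorem onSites_comp (Φ Ψ : SuperOp (Fin d × Fin d)) {x y : Fin N} (hxy : x ≠ y)
    (X : ChainOp (Fin d) N) :
    onSites Φ x y (onSites Ψ x y X) = onSites (Φ ∘ₗ Ψ) x y X := by
  ext i j
  simp only [onSites_apply, setPair_setPair hxy, setPair_left hxy, setPair_right]
  rfl

theorem onSites_id {x y : Fin N} (hxy : x ≠ y) (X : ChainOp (Fin d) N) :
    onSites LinearMap.id x y X = X := by
  ext i j
  simp only [onSites_apply, LinearMap.id_apply, Matrix.of_apply, setPair_self hxy]

theorem LocalOn.mono {b c : Set (Fin N)} (h : b ⊆ c) {f : ChainOp (Fin d) N} (hf : LocalOn b f) :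
    LocalOn c f := fun i i' j j' hi hj =>
  hf i i' j j' (fun s hs => hi s (h hs)) fun s hs => hj s (h hs)

theorem LocalOn.hadamard {b : Set (Fin N)} {f g : ChainOp (Fin d) N} (hf : LocalOn b f)
    (hg : LocalOn b g) : LocalOn b (f ⊙ g) := fun i i' j j' hi hj => by
  rw [Matrix.hadamard_apply, Matrix.hadamard_apply, hf i i' j j' hi hj, hg i i' j j' hi hj]

theorem LocalOn.onSites {b : Set (Fin N)} {f : ChainOp (Fin d) N} (hf : LocalOn b f)
    (Ψ : SuperOp (Fin d × Fin d)) {x y : Fin N} (hx : x ∈ b) (hy : y ∈ b) :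
    LocalOn b (onSites Ψ x y f) := fun i i' j j' hi hj => by
  rw [onSites_apply, onSites_apply, hi x hx, hi y hy, hj x hx, hj y hy]
  exact congrFun (congrFun (congrArg Ψ (Matrix.ext fun a c =>
    hf _ _ _ _ (setPair_congr hi a) (setPair_congr hj c))) _) _

theorem onSites_hadamard (Ψ : SuperOp (Fin d × Fin d)) {x y : Fin N} {b : Set (Fin N)}
    (hx : x ∉ b) (hy : y ∉ b) (f : ChainOp (Fin d) N) {g : ChainOp (Fin d) N}
    (hg : LocalOn b g) : onSites Ψ x y (f ⊙ g) = onSites Ψ x y f ⊙ g := by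
  ext i j
  have h1 : (Matrix.of fun a c => (f ⊙ g) (setPair i x y a) (setPair j x y c)) =
      g i j • Matrix.of fun a c => f (setPair i x y a) (setPair j x y c) := by
    ext a c
    have hset : ∀ (l : Fin N → Fin d) a, ∀ s ∈ b, setPair l x y a s = l s := fun l a s hs =>
      setPair_of_ne (by rintro rfl; exact hx hs) (by rintro rfl; exact hy hs) l a
    simp only [Matrix.of_apply, Matrix.hadamard_apply, Matrix.smul_apply, smul_eq_mul]
    rw [hg _ i _ j (hset i a) (hset j c), mul_comm]
  rw [onSites_apply, h1, map_smul, Matrix.smul_apply, Matrix.hadamard_apply, onSites_apply,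
    smul_eq_mul, mul_comm]

open Classical in
/-- The functional that traces out the sites of `S`. -/
noncomputable def traceOut (S : Set (Fin N)) : ChainOp (Fin d) N :=
  Matrix.of fun i j => if ∀ s ∈ S, i s = j s then 1 else 0

theorem localOn_traceOut (S : Set (Fin N)) : LocalOn S (traceOut S : ChainOp (Fin d) N) := by
  intro i i' j j' hi hj
  simp only [traceOut, Matrix.of_apply]
  congr 1
  exact propext (forall₂_congr fun s hs => by rw [hi s hs, hj s hs])

theorem traceOut_union (S T : Set (Fin N)) :
    (traceOut (S ∪ T) : ChainOp (Fin d) N) = traceOut S ⊙ traceOut T := by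
  ext i j
  simp only [traceOut, Matrix.of_apply, Matrix.hadamard_apply, ite_mul, one_mul, zero_mul,
    ← ite_and]
  congr 1
  simp only [Set.mem_union, or_imp, forall_and]

/-- A trace-preserving gate inside a traced-out region disappears: the trace over its two sites
splits off as a factor. -/
theorem onSites_traceOut {Φ : SuperOp (Fin d × Fin d)} (hΦ : IsReversible Φ) {x y : Fin N}
    (hxy : x ≠ y) {S : Set (Fin N)} (hx : x ∈ S) (hy : y ∈ S) :
    onSites (transposeOp Φ) x y (traceOut S) = traceOut S := by
  have hS : S = {x, y} ∪ (S \ {x, y}) := by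
    rw [Set.union_sdiff_cancel]
    rintro s (rfl | rfl) <;> assumption
  rw [hS, traceOut_union, onSites_hadamard _ (by simp) (by simp) _ (localOn_traceOut _)]
  congr 1
  ext i j
  have h1 : (Matrix.of fun a c => (traceOut {x, y} : ChainOp (Fin d) N) (setPair i x y a)
      (setPair j x y c)) = 1 := by
    ext a c
    simp [traceOut, setPair_left hxy, setPair_right, Matrix.one_apply, Prod.ext_iff]
  rw [onSites_apply, h1, hΦ.transposeOp_one]
  simp [traceOut, Matrix.one_apply]

end Gates

/-! ### The two properties that survive gates not crossing region boundaries. -/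

section LocalProperties

variable {d N : ℕ}

/-- A property of an operator and two disjoint regions that passes to smaller regions and is
preserved by reversible gates that do not cross the boundaries of the regions. -/
structure IsLocalProperty (P : Set (Fin N) → Set (Fin N) → ChainOp (Fin d) N → Prop) : Prop where
  mono : ∀ {b₁ b₂ c₁ c₂ X}, Disjoint b₁ b₂ → c₁ ⊆ b₁ → c₂ ⊆ b₂ → P b₁ b₂ X → P c₁ c₂ X
  gate : ∀ {b₁ b₂ X} {Φ : SuperOp (Fin d × Fin d)} {x y : Fin N}, IsReversible Φ → x ≠ y →
    Disjoint b₁ b₂ → (x ∈ b₁ ↔ y ∈ b₁) → (x ∈ b₂ ↔ y ∈ b₂) → P b₁ b₂ X →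
      P b₁ b₂ (onSites Φ x y X)

/-- Two regions are independent: if a product functional annihilates the operator for all
functionals on the remaining sites, then so does one of its factors. -/
def Independent (b₁ b₂ : Set (Fin N)) (X : ChainOp (Fin d) N) : Prop :=
  ∀ f₁ f₂, LocalOn b₁ f₁ → LocalOn b₂ f₂ →
    (∀ g, LocalOn (b₁ ∪ b₂)ᶜ g → pairing (f₁ ⊙ (f₂ ⊙ g)) X = 0) →
      (∀ g, LocalOn b₁ᶜ g → pairing (f₁ ⊙ g) X = 0) ∨
        ∀ g, LocalOn b₂ᶜ g → pairing (f₂ ⊙ g) X = 0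

/-- The operator Schmidt rank between two regions, with all other sites traced out, is at most the
cardinality of `κ`. -/
def SchmidtRankLE (κ : Type) [Fintype κ] (b₁ b₂ : Set (Fin N)) (X : ChainOp (Fin d) N) : Prop :=
  ∃ α β : κ → (ChainOp (Fin d) N →ₗ[ℂ] ℂ), ∀ f₁ f₂, LocalOn b₁ f₁ → LocalOn b₂ f₂ →
    pairing (f₁ ⊙ (f₂ ⊙ traceOut (b₁ ∪ b₂)ᶜ)) X = ∑ k, α k f₁ * β k f₂

theorem hadamard_left_comm' (f g h : ChainOp (Fin d) N) : f ⊙ (g ⊙ h) = g ⊙ (f ⊙ h) := by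
  rw [← Matrix.hadamard_assoc, Matrix.hadamard_comm f g, Matrix.hadamard_assoc]

theorem Independent.symm {b₁ b₂ : Set (Fin N)} {X : ChainOp (Fin d) N} (h : Independent b₁ b₂ X) :
    Independent b₂ b₁ X := fun f₂ f₁ h2 h1 hg =>
  (h f₁ f₂ h1 h2 fun g hgl => by
    rw [hadamard_left_comm']
    exact hg g (by rwa [Set.union_comm])).symm

theorem SchmidtRankLE.symm {κ : Type} [Fintype κ] {b₁ b₂ : Set (Fin N)} {X : ChainOp (Fin d) N}
    (h : SchmidtRankLE κ b₁ b₂ X) : SchmidtRankLE κ b₂ b₁ X := by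
  obtain ⟨α, β, hαβ⟩ := h
  refine ⟨β, α, fun f₂ f₁ h2 h1 => ?_⟩
  rw [hadamard_left_comm', Set.union_comm, hαβ f₁ f₂ h1 h2]
  exact Finset.sum_congr rfl fun k _ => mul_comm _ _

/-- Expand in indicators of the configuration on `S`; `splice` overwrites that part, so the second
factor no longer depends on it. -/
theorem LocalOn.exists_sum_hadamard {S T : Set (Fin N)} {f : ChainOp (Fin d) N}
    (hf : LocalOn (S ∪ T) f) : ∃ (κ : Type) (_ : Fintype κ) (g h : κ → ChainOp (Fin d) N),
      (∀ k, LocalOn S (g k)) ∧ (∀ k, LocalOn T (h k)) ∧ f = ∑ k, g k ⊙ h k := by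
  classical
  let splice : (S → Fin d) → (Fin N → Fin d) → Fin N → Fin d := fun p i s =>
    if hs : s ∈ S then p ⟨s, hs⟩ else i s
  refine ⟨(S → Fin d) × (S → Fin d), inferInstance,
    fun k => Matrix.of fun i j => if (fun s : S => i s) = k.1 ∧ (fun s : S => j s) = k.2 then 1 else 0,
    fun k => Matrix.of fun i j => f (splice k.1 i) (splice k.2 j), fun k => ?_, fun k => ?_, ?_⟩
  · intro i i' j j' hi hj
    simp only [Matrix.of_apply]
    rw [show (fun s : S => i s) = fun s : S => i' s from funext fun s => hi s s.2,
      show (fun s : S => j s) = fun s : S => j' s from funext fun s => hj s s.2]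
  · have hs : ∀ (p : S → Fin d) (i i' : Fin N → Fin d), (∀ s ∈ T, i s = i' s) →
        ∀ s ∈ S ∪ T, splice p i s = splice p i' s := by
      intro p i i' hi s hs
      by_cases h : s ∈ S
      · simp [splice, h]
      · simp [splice, h, hi s (hs.resolve_left h)]
    exact fun i i' j j' hi hj => hf _ _ _ _ (hs _ _ _ hi) (hs _ _ _ hj)
  · ext i j
    have hself : ∀ i : Fin N → Fin d, splice (fun s : S => i s) i = i := fun i => by
      funext s
      simp [splice]
    rw [Matrix.sum_apply, Finset.sum_eq_single (fun s : S => i s, fun s : S => j s)]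
    · simp [hself]
    · intro k _ hk
      simp only [Matrix.hadamard_apply, Matrix.of_apply]
      rw [if_neg, zero_mul]
      rintro ⟨h1, h2⟩
      exact hk (Prod.ext h1.symm h2.symm)
    · simp

/-- A functional detecting `X` through `f` is a sum of products, one factor on b \ c and one outside
`b`; some product must detect `X` as well. -/
theorem Independent.exists_or_forall {b c : Set (Fin N)} {X f : ChainOp (Fin d) N} :
    (∀ g, LocalOn cᶜ g → pairing (f ⊙ g) X = 0) ∨
      ∃ φ g, LocalOn (b \ c) φ ∧ LocalOn bᶜ g ∧ pairing ((f ⊙ φ) ⊙ g) X ≠ 0 := by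
  by_contra! hne
  obtain ⟨⟨g, hg, hgX⟩, h2⟩ := hne
  have hg' : LocalOn ((b \ c) ∪ bᶜ) g := hg.mono fun s hs => by
    by_cases h : s ∈ b
    · exact Or.inl ⟨h, hs⟩
    · exact Or.inr h
  obtain ⟨κ, _, φ, w, hφ, hw, rfl⟩ := hg'.exists_sum_hadamard
  refine hgX ?_
  rw [show f ⊙ ∑ k, φ k ⊙ w k = ∑ k, (f ⊙ φ k) ⊙ w k by
    ext i j
    simp [Matrix.sum_apply, Finset.mul_sum, mul_assoc], pairing_sum_left]
  exact Finset.sum_eq_zero fun k _ => h2 _ _ (hφ k) (hw k)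

/-- If neither factor annihilates `X`, each can be multiplied by a functional on its larger region
so that it still does not. The enlarged product still annihilates `X`, contradicting independence of
the larger regions. -/
theorem Independent.mono {b₁ b₂ c₁ c₂ : Set (Fin N)} {X : ChainOp (Fin d) N}
    (hb : Disjoint b₁ b₂) (h1 : c₁ ⊆ b₁) (h2 : c₂ ⊆ b₂) (h : Independent b₁ b₂ X) :
    Independent c₁ c₂ X := by
  intro f₁ f₂ hf₁ hf₂ hg
  rcases Independent.exists_or_forall (b := b₁) (c := c₁) (X := X) (f := f₁) with
    h3 | ⟨φ₁, g₁, hφ₁, hg₁, hX₁⟩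
  · exact Or.inl h3
  rcases Independent.exists_or_forall (b := b₂) (c := c₂) (X := X) (f := f₂) with
    h4 | ⟨φ₂, g₂, hφ₂, hg₂, hX₂⟩
  · exact Or.inr h4
  refine ((h (f₁ ⊙ φ₁) (f₂ ⊙ φ₂) ((hf₁.mono h1).hadamard (hφ₁.mono Set.sdiff_subset))
    ((hf₂.mono h2).hadamard (hφ₂.mono Set.sdiff_subset)) fun g hgl => ?_).elim
    (fun h5 => hX₁ (h5 g₁ hg₁)) fun h5 => hX₂ (h5 g₂ hg₂)).elim
  · have := hg (φ₁ ⊙ (φ₂ ⊙ g)) ((hφ₁.mono ?_).hadamard ((hφ₂.mono ?_).hadamard (hgl.mono ?_)))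
    · rw [← this]
      congr 1
      ext i j
      simp only [Matrix.hadamard_apply]
      ring
    · rintro s ⟨hs, hs'⟩ (h6 | h6)
      · exact hs' h6
      · exact Set.disjoint_left.1 hb hs (h2 h6)
    · rintro s ⟨hs, hs'⟩ (h6 | h6)
      · exact Set.disjoint_left.1 hb (h1 h6) hs
      · exact hs' h6
    · exact Set.compl_subset_compl.2 (Set.union_subset_union h1 h2)

theorem pairing_onSites_hadamard {Φ : SuperOp (Fin d × Fin d)} {x y : Fin N} (hxy : x ≠ y)
    {b : Set (Fin N)} (hx : x ∉ b) (hy : y ∉ b) (f : ChainOp (Fin d) N) {g : ChainOp (Fin d) N}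
    (hg : LocalOn b g) (X : ChainOp (Fin d) N) :
    pairing (f ⊙ g) (onSites Φ x y X) = pairing (onSites (transposeOp Φ) x y f ⊙ g) X := by
  rw [pairing_onSites Φ hxy, onSites_hadamard _ hx hy _ hg]

/-- The transposed gate is absorbed into the functional on `b₁`, or, for the conclusion about `b₂`,
into the test functional outside `b₂`. -/
theorem Independent.gate_of_mem {b₁ b₂ : Set (Fin N)} {X : ChainOp (Fin d) N}
    {Φ : SuperOp (Fin d × Fin d)} {x y : Fin N} (hxy : x ≠ y)
    (hb : Disjoint b₁ b₂) (hx : x ∈ b₁) (hy : y ∈ b₁) (h : Independent b₁ b₂ X) :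
    Independent b₁ b₂ (onSites Φ x y X) := by
  intro f₁ f₂ hf₁ hf₂ hg
  have hx' : x ∉ b₁ᶜ := fun h => h hx
  have hy' : y ∉ b₁ᶜ := fun h => h hy
  have hx2 : x ∉ b₂ := Set.disjoint_left.1 hb hx
  have hy2 : y ∉ b₂ := Set.disjoint_left.1 hb hy
  have hsub : b₂ ⊆ b₁ᶜ := Set.subset_compl_iff_disjoint_left.2 hb
  refine (h (onSites (transposeOp Φ) x y f₁) f₂ (hf₁.onSites _ hx hy) hf₂ fun g hgl => ?_).imp
    (fun h1 g hgl => ?_) fun h2 g hgl => ?_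
  · rw [← pairing_onSites_hadamard hxy hx' hy' f₁ ((hf₂.mono hsub).hadamard
      (hgl.mono (Set.compl_subset_compl.2 Set.subset_union_left)))]
    exact hg g hgl
  · rw [pairing_onSites_hadamard hxy hx' hy' _ hgl]
    exact h1 g hgl
  · rw [Matrix.hadamard_comm, pairing_onSites_hadamard hxy hx2 hy2 _ hf₂, Matrix.hadamard_comm]
    exact h2 _ (hgl.onSites _ hx2 hy2)

theorem onSites_transposeOp_cancel {Φ Ψ : SuperOp (Fin d × Fin d)} {x y : Fin N} (hxy : x ≠ y)
    (h : Ψ ∘ₗ Φ = LinearMap.id) (g : ChainOp (Fin d) N) :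
    onSites (transposeOp Φ) x y (onSites (transposeOp Ψ) x y g) = g := by
  have hid : transposeOp Φ ∘ₗ transposeOp Ψ = LinearMap.id :=
    LinearMap.ext fun Y => transposeOp_transposeOp_of_comp_eq_id h Y
  rw [onSites_comp _ _ hxy, hid, onSites_id hxy]

theorem isLocalProperty_independent : IsLocalProperty (Independent (d := d) (N := N)) where
  mono hb h1 h2 h := h.mono hb h1 h2
  gate {b₁ b₂ X Φ x y} hΦ hxy hb h1 h2 h := by
    by_cases hx1 : x ∈ b₁
    · exact h.gate_of_mem hxy hb hx1 (h1.1 hx1)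
    by_cases hx2 : x ∈ b₂
    · exact (h.symm.gate_of_mem hxy hb.symm hx2 (h2.1 hx2)).symm
    have hy1 : y ∉ b₁ := fun hy => hx1 (h1.2 hy)
    have hy2 : y ∉ b₂ := fun hy => hx2 (h2.2 hy)
    intro f₁ f₂ hf₁ hf₂ hg
    obtain ⟨Ψ, -, hΨ, -⟩ := hΦ.exists_inverse
    have hxc : x ∉ b₁ ∪ b₂ := by simp [hx1, hx2]
    have hyc : y ∉ b₁ ∪ b₂ := by simp [hy1, hy2]
    refine (h f₁ f₂ hf₁ hf₂ fun g hgl => ?_).imp (fun h1 g hgl => ?_) fun h2 g hgl => ?_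
    -- For a gate outside both regions, invertibility matters: the test functional is chosen so that
    -- the transposed gate turns it into `g`.
    · have := hg (onSites (transposeOp Ψ) x y g) (hgl.onSites _ hxc hyc)
      rw [← Matrix.hadamard_assoc, Matrix.hadamard_comm, pairing_onSites_hadamard hxy hxc hyc _
        ((hf₁.mono Set.subset_union_left).hadamard (hf₂.mono Set.subset_union_right)),
        onSites_transposeOp_cancel hxy hΨ, Matrix.hadamard_comm, Matrix.hadamard_assoc] at this
      exact this
    · rw [Matrix.hadamard_comm, pairing_onSites_hadamard hxy hx1 hy1 _ hf₁, Matrix.hadamard_comm]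
      exact h1 _ (hgl.onSites _ hx1 hy1)
    · rw [Matrix.hadamard_comm, pairing_onSites_hadamard hxy hx2 hy2 _ hf₂, Matrix.hadamard_comm]
      exact h2 _ (hgl.onSites _ hx2 hy2)

/-- Entrywise multiplication by a fixed operator. -/
def hadamardRight (g : ChainOp (Fin d) N) : ChainOp (Fin d) N →ₗ[ℂ] ChainOp (Fin d) N where
  toFun f := f ⊙ g
  map_add' f f' := Matrix.add_hadamard g f f'
  map_smul' c f := Matrix.smul_hadamard f g c

theorem SchmidtRankLE.gate_of_mem {κ : Type} [Fintype κ] {b₁ b₂ : Set (Fin N)}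
    {X : ChainOp (Fin d) N} {Φ : SuperOp (Fin d × Fin d)} {x y : Fin N} (hxy : x ≠ y)
    (hb : Disjoint b₁ b₂) (hx : x ∈ b₁) (hy : y ∈ b₁) (h : SchmidtRankLE κ b₁ b₂ X) :
    SchmidtRankLE κ b₁ b₂ (onSites Φ x y X) := by
  obtain ⟨α, β, hαβ⟩ := h
  refine ⟨fun k => α k ∘ₗ onSites (transposeOp Φ) x y, β, fun f₁ f₂ hf₁ hf₂ => ?_⟩
  rw [pairing_onSites_hadamard hxy (b := b₁ᶜ) (fun h => h hx) (fun h => h hy) f₁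
    ((hf₂.mono (Set.subset_compl_iff_disjoint_left.2 hb)).hadamard
      ((localOn_traceOut _).mono (Set.compl_subset_compl.2 Set.subset_union_left))),
    hαβ _ _ (hf₁.onSites _ hx hy) hf₂]
  rfl

/-- Shrinking a region traces out the lost sites, which is a linear operation on its functional. A
gate inside a region acts linearly on that functional, and one outside both vanishes by trace
preservation. -/
theorem isLocalProperty_schmidtRankLE (κ : Type) [Fintype κ] :
    IsLocalProperty (SchmidtRankLE (d := d) (N := N) κ) where
  mono {b₁ b₂ c₁ c₂ X} hb h1 h2 h := by
    obtain ⟨α, β, hαβ⟩ := h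
    refine ⟨fun k => α k ∘ₗ hadamardRight (traceOut (b₁ \ c₁)),
      fun k => β k ∘ₗ hadamardRight (traceOut (b₂ \ c₂)), fun f₁ f₂ hf₁ hf₂ => ?_⟩
    have hset : (c₁ ∪ c₂)ᶜ = (b₁ \ c₁) ∪ ((b₂ \ c₂) ∪ (b₁ ∪ b₂)ᶜ) := by
      ext s
      have h3 : s ∈ b₁ → s ∉ b₂ := fun h => Set.disjoint_left.1 hb h
      have h4 : s ∈ c₁ → s ∈ b₁ := fun h => h1 h
      have h5 : s ∈ c₂ → s ∈ b₂ := fun h => h2 h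
      simp only [Set.mem_compl_iff, Set.mem_union, Set.mem_sdiff]
      tauto
    have := hαβ (f₁ ⊙ traceOut (b₁ \ c₁)) (f₂ ⊙ traceOut (b₂ \ c₂))
      ((hf₁.mono h1).hadamard ((localOn_traceOut _).mono Set.sdiff_subset))
      ((hf₂.mono h2).hadamard ((localOn_traceOut _).mono Set.sdiff_subset))
    refine Eq.trans ?_ this
    rw [hset, traceOut_union, traceOut_union]
    congr 1
    ext i j
    simp only [Matrix.hadamard_apply]
    ring
  gate {b₁ b₂ X Φ x y} hΦ hxy hb h1 h2 h := by
    by_cases hx1 : x ∈ b₁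
    · exact h.gate_of_mem hxy hb hx1 (h1.1 hx1)
    by_cases hx2 : x ∈ b₂
    · exact (h.symm.gate_of_mem hxy hb.symm hx2 (h2.1 hx2)).symm
    have hy1 : y ∉ b₁ := fun hy => hx1 (h1.2 hy)
    have hy2 : y ∉ b₂ := fun hy => hx2 (h2.2 hy)
    have hxc : x ∉ b₁ ∪ b₂ := by simp [hx1, hx2]
    have hyc : y ∉ b₁ ∪ b₂ := by simp [hy1, hy2]
    obtain ⟨α, β, hαβ⟩ := h
    refine ⟨α, β, fun f₁ f₂ hf₁ hf₂ => ?_⟩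
    rw [← hαβ f₁ f₂ hf₁ hf₂, ← Matrix.hadamard_assoc, Matrix.hadamard_comm,
      pairing_onSites_hadamard hxy hxc hyc _
        ((hf₁.mono Set.subset_union_left).hadamard (hf₂.mono Set.subset_union_right)),
      onSites_traceOut hΦ hxy hxc hyc]

end LocalProperties

/-! ### Brickwork circuits: one site lost at each end per layer. -/

section Circuits

variable {d N : ℕ}

theorem pairing_traceOut_univ (X : ChainOp (Fin d) N) : pairing (traceOut Set.univ) X = X.trace := by
  classical
  have h : (traceOut Set.univ : ChainOp (Fin d) N) = 1 := by
    ext i j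
    simp [traceOut, Matrix.one_apply, funext_iff]
  rw [h]
  simp [pairing, Matrix.one_apply, Matrix.trace]

theorem IsReversible.trace_onSites {Φ : SuperOp (Fin d × Fin d)} (hΦ : IsReversible Φ)
    {x y : Fin N} (hxy : x ≠ y) (X : ChainOp (Fin d) N) : (onSites Φ x y X).trace = X.trace := by
  rw [← pairing_traceOut_univ, pairing_onSites Φ hxy,
    onSites_traceOut hΦ hxy (Set.mem_univ x) (Set.mem_univ y), pairing_traceOut_univ]

theorem gateLeft_ne_gateRight (hN : Even N) (s : ℕ) (k : Fin (N / 2)) :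
    gateLeft s k ≠ gateRight s k := by
  intro h
  have h1 : 2 * k.1 + s % 2 = (2 * k.1 + s % 2 + 1) % N := congrArg Fin.val h
  have h2 := k.2
  obtain ⟨m, rfl⟩ := hN
  rcases Nat.lt_or_ge (2 * k.1 + s % 2 + 1) (m + m) with h3 | h3
  · rw [Nat.mod_eq_of_lt h3] at h1
    omega
  · rw [show 2 * k.1 + s % 2 + 1 = m + m by omega, Nat.mod_self] at h1
    omega

/-- Ends of the parity of `s` fall between gates. The wrap-around gate on sites N − 1 and 0 occurs
only for odd `s`; then `lo` and `hi` are odd, and both sites lie outside the segment. -/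
theorem gateLeft_mem_segment_iff (hN : Even N) {s lo hi : ℕ} (hlo : lo % 2 = s % 2)
    (hhi : hi % 2 = s % 2) (hhiN : hi ≤ N) (k : Fin (N / 2)) :
    gateLeft s k ∈ segment N lo hi ↔ gateRight s k ∈ segment N lo hi := by
  have h2 := k.2
  obtain ⟨m, rfl⟩ := hN
  simp only [segment, Set.mem_ofPred_eq, gateLeft, gateRight]
  rcases Nat.lt_or_ge (2 * k.1 + s % 2 + 1) (m + m) with h3 | h3
  · rw [Nat.mod_eq_of_lt h3]
    omega
  · rw [show 2 * k.1 + s % 2 + 1 = m + m by omega, Nat.mod_self]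
    omega

theorem layer_induction {p : Module.End ℂ (ChainOp (Fin d) N) → Prop} (h1 : p 1)
    (hmul : ∀ E F, p E → p F → p (E * F)) (s : ℕ) (G : Fin (N / 2) → SuperOp (Fin d × Fin d))
    (hG : ∀ k, p (onSites (G k) (gateLeft s k) (gateRight s k))) : p (layer s G) := by
  rw [layer]
  refine List.prod_induction p hmul h1 fun E hE => ?_
  obtain ⟨k, rfl⟩ := List.mem_ofFn.1 hE
  exact hG k

theorem trace_brickwork (hN : Even N) {G : ℕ → Fin (N / 2) → SuperOp (Fin d × Fin d)} {t : ℕ}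
    (hG : ∀ s, s < t → ∀ k, IsReversible (G s k)) (X : ChainOp (Fin d) N) :
    (brickwork G t X).trace = X.trace := by
  induction t with
  | zero => rfl
  | succ t ih =>
    have hl : ∀ X, (layer t (G t) X).trace = X.trace :=
      layer_induction (p := fun E => ∀ X, (E X).trace = X.trace) (fun X => rfl)
        (fun E F hE hF X => (hE _).trans (hF X)) t (G t) fun k X =>
          (hG t (by omega) k).trace_onSites (gateLeft_ne_gateRight hN t k) X
    rw [brickwork, Module.End.mul_apply, hl, ih fun s hs => hG s (by omega)]

variable {P : Set (Fin N) → Set (Fin N) → ChainOp (Fin d) N → Prop}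

theorem IsLocalProperty.layer_iff (hP : IsLocalProperty P) (hN : Even N)
    {b₁ b₂ : Set (Fin N)} (hb : Disjoint b₁ b₂) {s : ℕ}
    (h1 : ∀ k, gateLeft s k ∈ b₁ ↔ gateRight s k ∈ b₁)
    (h2 : ∀ k, gateLeft s k ∈ b₂ ↔ gateRight s k ∈ b₂)
    {G : Fin (N / 2) → SuperOp (Fin d × Fin d)} (hG : ∀ k, IsReversible (G k))
    (X : ChainOp (Fin d) N) : P b₁ b₂ (layer s G X) ↔ P b₁ b₂ X := by
  refine layer_induction (p := fun E => ∀ X, P b₁ b₂ (E X) ↔ P b₁ b₂ X) (fun X => Iff.rfl)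
    (fun E F hE hF X => (hE _).trans (hF X)) s G (fun k X => ⟨fun h => ?_, fun h => ?_⟩) X
  · have hxy := gateLeft_ne_gateRight hN s k
    obtain ⟨Ψ, hΨ, h3, -⟩ := (hG k).exists_inverse
    have := hP.gate hΨ hxy hb (h1 k) (h2 k) h
    rwa [onSites_comp _ _ hxy, h3, onSites_id hxy] at this
  · exact hP.gate (hG k) (gateLeft_ne_gateRight hN s k) hb (h1 k) (h2 k) h

/-- The property holds for two opposite quarters of the ring, up to `m` sites at their ends. -/
def OnQuarters (P : Set (Fin N) → Set (Fin N) → ChainOp (Fin d) N → Prop) (Q m : ℕ)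
    (X : ChainOp (Fin d) N) : Prop :=
  P (segment N m (Q - m)) (segment N (2 * Q + m) (3 * Q - m)) X

theorem disjoint_segment {lo hi lo' hi' : ℕ} (h : hi ≤ lo') :
    Disjoint (segment N lo hi) (segment N lo' hi') := by
  rw [Set.disjoint_left]
  rintro s ⟨_, h1⟩ ⟨h2, _⟩
  omega

theorem segment_subset {lo hi lo' hi' : ℕ} (h : lo' ≤ lo) (h' : hi ≤ hi') :
    segment N lo hi ⊆ segment N lo' hi' := fun _ hs => ⟨h.trans hs.1, hs.2.trans_le h'⟩

theorem IsLocalProperty.onQuarters_mono (hP : IsLocalProperty P) {Q m m' : ℕ} (hm : m ≤ m')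
    {X : ChainOp (Fin d) N} (h : OnQuarters P Q m X) : OnQuarters P Q m' X :=
  hP.mono (disjoint_segment (by omega)) (segment_subset hm (by omega))
    (segment_subset (by omega) (by omega)) h

/-- As `Q` is even, the four ends m, Q − m, 2Q + m and 3Q − m all have the parity of `m`. -/
theorem IsLocalProperty.onQuarters_layer_iff (hP : IsLocalProperty P) {Q m s : ℕ} (hN : N = 4 * Q)
    (hQ : Even Q) (hm : m ≤ Q) (hms : m % 2 = s % 2) {G : Fin (N / 2) → SuperOp (Fin d × Fin d)}
    (hG : ∀ k, IsReversible (G k)) (X : ChainOp (Fin d) N) :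
    OnQuarters P Q m (layer s G X) ↔ OnQuarters P Q m X := by
  have hNe : Even N := hN ▸ hQ.mul_left 4
  obtain ⟨c, rfl⟩ := hQ
  exact hP.layer_iff hNe (disjoint_segment (by omega))
    (gateLeft_mem_segment_iff hNe hms (by omega) (by omega))
    (gateLeft_mem_segment_iff hNe (by omega) (by omega) (by omega)) hG X

/-- Exactly one of m and m + 1 has the parity of the layer, so the regions are trimmed either after
or before crossing it. -/
theorem IsLocalProperty.onQuarters_layer (hP : IsLocalProperty P) {Q m s : ℕ} (hN : N = 4 * Q)
    (hQ : Even Q) (hm : m + 1 ≤ Q) {G : Fin (N / 2) → SuperOp (Fin d × Fin d)}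
    (hG : ∀ k, IsReversible (G k)) (X : ChainOp (Fin d) N) :
    (OnQuarters P Q m X → OnQuarters P Q (m + 1) (layer s G X)) ∧
      (OnQuarters P Q m (layer s G X) → OnQuarters P Q (m + 1) X) := by
  rcases Nat.mod_two_eq_zero_or_one (m + s) with h | h
  · have := hP.onQuarters_layer_iff hN hQ (by omega) (show m % 2 = s % 2 by omega) hG X
    exact ⟨fun h1 => hP.onQuarters_mono (Nat.le_succ m) (this.2 h1),
      fun h1 => hP.onQuarters_mono (Nat.le_succ m) (this.1 h1)⟩
  · have := hP.onQuarters_layer_iff hN hQ hm (show (m + 1) % 2 = s % 2 by omega) hG X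
    exact ⟨fun h1 => this.2 (hP.onQuarters_mono (Nat.le_succ m) h1),
      fun h1 => this.1 (hP.onQuarters_mono (Nat.le_succ m) h1)⟩

/-- Local properties pass from one operator to the other, in both directions, at the cost of `t`
sites at each end of the regions; the traces agree. -/
structure IsLinked (t : ℕ) (X Y : ChainOp (Fin d) N) : Prop where
  trace_eq : Y.trace = X.trace
  forward : ∀ {P : Set (Fin N) → Set (Fin N) → ChainOp (Fin d) N → Prop}, IsLocalProperty P →
    ∀ Q, N = 4 * Q → Even Q → t ≤ Q → OnQuarters P Q 0 X → OnQuarters P Q t Y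
  backward : ∀ {P : Set (Fin N) → Set (Fin N) → ChainOp (Fin d) N → Prop}, IsLocalProperty P →
    ∀ Q, N = 4 * Q → Even Q → t ≤ Q → OnQuarters P Q 0 Y → OnQuarters P Q t X

theorem IsLinked.symm {t : ℕ} {X Y : ChainOp (Fin d) N} (h : IsLinked t X Y) : IsLinked t Y X :=
  ⟨h.trace_eq.symm, h.backward, h.forward⟩

theorem IsNondegenerateBrickwork.isLinked {t : ℕ} (hN : Even N)
    {E : Module.End ℂ (ChainOp (Fin d) N)} (hE : IsNondegenerateBrickwork t E)
    (X : ChainOp (Fin d) N) : IsLinked t X (E X) := by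
  obtain ⟨G, hG, rfl⟩ := hE
  have hG' : ∀ s, s < t → ∀ k, IsReversible (G s k) := fun s hs k => (hG s hs k).isReversible
  clear hG
  refine ⟨trace_brickwork hN hG' X, fun {P} hP Q hNQ hQ ht h => ?_, fun {P} hP Q hNQ hQ ht h => ?_⟩
  · induction t with
    | zero => exact h
    | succ t ih =>
      exact (hP.onQuarters_layer hNQ hQ ht (hG' t (by omega)) _).1
        (ih (fun s hs => hG' s (by omega)) (by omega))
  -- Backwards, the last layer is undone first, so the induction must start from an arbitrary
  -- trimming `m`.
  · have key : ∀ m, m + t ≤ Q → OnQuarters P Q m (brickwork G t X) → OnQuarters P Q (m + t) X := by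
      clear h ht
      induction t with
      | zero => exact fun m _ h => h
      | succ t ih =>
        intro m hm h
        rw [← add_assoc, add_right_comm]
        exact ih (fun s hs => hG' s (by omega)) (m + 1) (by omega)
          ((hP.onQuarters_layer hNQ hQ (by omega) (hG' t (by omega)) _).2 h)
    simpa using key 0 (by omega) h

end Circuits

/-! ### Independence for injective tensors, and its consequence for a sum. -/

section Evaluation

variable {n p N d χ v u : ℕ}

theorem TraceSplits.ringOp {A : LocalTensor (Fin p → Fin d) χ} {B : LocalTensor (Fin p → Fin d) v}
    {C : LocalTensor (Fin p → Fin d) u} (hs : TraceSplits A B C) (h : n * p = N) :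
    ringOp h A = ringOp h B + ringOp h C := by
  ext i j
  exact hs _

theorem pairing_add_right (f X Y : ChainOp (Fin d) N) :
    pairing f (X + Y) = pairing f X + pairing f Y := by
  simp [pairing, mul_add, Finset.sum_add_distrib]

theorem exists_mem_cell (h : n * p = N) (s : Fin N) :
    ∃ x : Fin n, s ∈ segment N (x * p) ((x + 1) * p) := by
  obtain ⟨⟨x, y⟩, rfl⟩ := (finProdFinEquiv.trans (finCongr h)).surjective s
  have hval : ((finProdFinEquiv.trans (finCongr h)) (x, y)).1 = y + x * p := by
    rw [Equiv.trans_apply, finCongr_apply, Fin.val_cast, finProdFinEquiv_apply_val, mul_comm p]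
  have hy := y.2
  exact ⟨x, by omega, by rw [hval, add_mul, one_mul]; omega⟩

theorem cell_disjoint {x y : Fin n} (hxy : x ≠ y) :
    Disjoint (segment N (x * p) ((x + 1) * p)) (segment N (y * p) ((y + 1) * p)) := by
  rcases lt_or_gt_of_ne (Fin.val_ne_of_ne hxy) with h | h
  · exact disjoint_segment (Nat.mul_le_mul_right p h)
  · exact (disjoint_segment (Nat.mul_le_mul_right p h)).symm

theorem traceOut_compl_cells (h : n * p = N) (x₁ x₂ : Fin n) (i j : Fin N → Fin d) :
    traceOut (segment N (x₁ * p) ((x₁ + 1) * p) ∪ segment N (x₂ * p) ((x₂ + 1) * p))ᶜ i j =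
      ∏ x, if x = x₁ ∨ x = x₂ then 1 else traceCoeff (Fin p → Fin d) (pairCells h (i, j) x) := by
  rw [traceOut, Matrix.of_apply]
  split_ifs with hij
  · refine (Finset.prod_eq_one fun x _ => ?_).symm
    split_ifs with hx
    · rfl
    · push Not at hx
      refine if_pos ((cells_eq_iff h i j x).2 fun s hs => hij s ?_)
      rintro (h1 | h1)
      · exact Set.disjoint_left.1 (cell_disjoint hx.1) hs h1
      · exact Set.disjoint_left.1 (cell_disjoint hx.2) hs h1
  · push Not at hij
    obtain ⟨s, hs, hne⟩ := hij
    obtain ⟨x, hx⟩ := exists_mem_cell h s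
    refine (Finset.prod_eq_zero (Finset.mem_univ x) ?_).symm
    rw [if_neg]
    · exact if_neg fun h1 => hne ((cells_eq_iff h i j x).1 h1 s hx)
    · rintro (rfl | rfl)
      · exact hs (Or.inl hx)
      · exact hs (Or.inr hx)

theorem pairing_traceOut_ringOp (h : n * p = N) (A : LocalTensor (Fin p → Fin d) χ) {x₁ x₂ : Fin n}
    (hx : x₁ ≠ x₂) (a₁ a₂ : (Fin p → Fin d) × (Fin p → Fin d) → ℂ) :
    pairing (onCell h x₁ a₁ ⊙ (onCell h x₂ a₂ ⊙ traceOut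
      (segment N (x₁ * p) ((x₁ + 1) * p) ∪ segment N (x₂ * p) ((x₂ + 1) * p))ᶜ)) (ringOp h A) =
      (List.ofFn fun x => if x = x₁ then contract A a₁ else
        if x = x₂ then contract A a₂ else transferMatrix A).prod.trace := by
  rw [pairing_prod_ringOp h A _ (fun x => if x = x₁ then a₁ else if x = x₂ then a₂ else
    traceCoeff (Fin p → Fin d))]
  · congr 3
    funext x
    split_ifs
    · rfl
    · rfl
    · exact (transferMatrix_eq_contract A).symm
  · intro i j
    rw [Matrix.hadamard_apply, Matrix.hadamard_apply, traceOut_compl_cells h]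
    have h1 : onCell h x₁ a₁ i j = ∏ x, if x = x₁ then a₁ (pairCells h (i, j) x) else 1 := by
      rw [Finset.prod_ite_eq' Finset.univ x₁, if_pos (Finset.mem_univ _)]
      rfl
    have h2 : onCell h x₂ a₂ i j = ∏ x, if x = x₂ then a₂ (pairCells h (i, j) x) else 1 := by
      rw [Finset.prod_ite_eq' Finset.univ x₂, if_pos (Finset.mem_univ _)]
      rfl
    rw [h1, h2, ← Finset.prod_mul_distrib, ← Finset.prod_mul_distrib]
    refine Finset.prod_congr rfl fun x _ => ?_
    by_cases hx1 : x = x₁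
    · subst hx1
      simp [hx]
    · by_cases hx2 : x = x₂
      · subst hx2
        simp [hx1]
      · simp [hx1, hx2]

/-- The product of coefficient functions on all cells but one. -/
def prodOff (h : n * p = N) (x : Fin n) (c : Fin n → (Fin p → Fin d) × (Fin p → Fin d) → ℂ) :
    ChainOp (Fin d) N :=
  Matrix.of fun i j => ∏ y ∈ Finset.univ.erase x, c y (pairCells h (i, j) y)

theorem localOn_prodOff (h : n * p = N) (x : Fin n)
    (c : Fin n → (Fin p → Fin d) × (Fin p → Fin d) → ℂ) :
    LocalOn (segment N (x * p) ((x + 1) * p))ᶜ (prodOff h x c) := by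
  intro i i' j j' hi hj
  rw [prodOff, Matrix.of_apply, Matrix.of_apply]
  refine Finset.prod_congr rfl fun y hy => ?_
  have hsub : ∀ s ∈ segment N (y * p) ((y + 1) * p), s ∈ (segment N (x * p) ((x + 1) * p))ᶜ :=
    fun s hs => Set.disjoint_left.1 (cell_disjoint (Finset.ne_of_mem_erase hy)) hs
  exact localOn_onCell h y (c y) i i' j j' (fun s hs => hi s (hsub s hs)) fun s hs => hj s (hsub s hs)

theorem pairing_prodOff_ringOp (h : n * p = N) (A : LocalTensor (Fin p → Fin d) χ) (x : Fin n)
    (c : Fin n → (Fin p → Fin d) × (Fin p → Fin d) → ℂ) :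
    pairing (onCell h x (c x) ⊙ prodOff h x c) (ringOp h A) =
      (List.ofFn fun y => contract A (c y)).prod.trace :=
  pairing_prod_ringOp h A _ c fun i j => by
    rw [← Finset.mul_prod_erase Finset.univ _ (Finset.mem_univ x)]
    rfl

theorem exists_trace_mul_ne_zero {M K : Matrix (Fin χ) (Fin χ) ℂ} (hM : M ≠ 0) (hK : K ≠ 0) :
    ∃ X Y, (M * X * K * Y).trace ≠ 0 := by
  obtain ⟨a, b, hab⟩ : ∃ a b, M a b ≠ 0 := by
    by_contra! h0
    exact hM (Matrix.ext h0)
  obtain ⟨c, e, hce⟩ : ∃ c e, K c e ≠ 0 := by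
    by_contra! h0
    exact hK (Matrix.ext h0)
  refine ⟨Matrix.single b c 1, Matrix.single e a 1, ?_⟩
  rw [Matrix.trace_mul_single, MulOpposite.op_one, one_smul]
  have : (M * (Matrix.single b c 1 : Matrix (Fin χ) (Fin χ) ℂ) * K) a e = M a b * K c e := by
    rw [Matrix.mul_apply, Finset.sum_eq_single c]
    · simp
    · intro k _ hk
      rw [Matrix.mul_single_apply_of_ne _ _ _ _ _ hk, zero_mul]
    · simp
  rw [this]
  exact mul_ne_zero hab hce

/-- The regions are cells 0 and 2. If both contractions are nonzero, injectivity realizes in cells 1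
and 3 matrices that make the trace of the product nonzero. -/
theorem onQuarters_independent_ringOp (h : 4 * p = N) {A : LocalTensor (Fin p → Fin d) χ}
    (hA : tensorSpan A = ⊤) : OnQuarters Independent p 0 (ringOp h A) := by
  have hs0 : segment N 0 (p - 0) = segment N ((0 : Fin 4) * p) (((0 : Fin 4) + 1) * p) := by simp
  have hs2 : segment N (2 * p + 0) (3 * p - 0) =
      segment N ((2 : Fin 4) * p) (((2 : Fin 4) + 1) * p) := by simp
  rw [OnQuarters, hs0, hs2]
  intro f₁ f₂ hf₁ hf₂ hg
  obtain ⟨a₁, rfl⟩ : ∃ a, f₁ = onCell h 0 a := ⟨_, hf₁.eq_onCell h (x := 0)⟩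
  obtain ⟨a₂, rfl⟩ : ∃ a, f₂ = onCell h 2 a := ⟨_, hf₂.eq_onCell h (x := 2)⟩
  by_cases h1 : contract A a₁ = 0
  · exact Or.inl fun g hgl => pairing_ringOp_eq_zero h A 0 a₁ h1 g hgl
  by_cases h2 : contract A a₂ = 0
  · exact Or.inr fun g hgl => pairing_ringOp_eq_zero h A 2 a₂ h2 g hgl
  exfalso
  obtain ⟨X, Y, hXY⟩ := exists_trace_mul_ne_zero h1 h2
  obtain ⟨c₁, rfl⟩ := exists_contract_eq hA X
  obtain ⟨c₃, rfl⟩ := exists_contract_eq hA Y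
  have hloc : ∀ (x : Fin 4) c, x ≠ 0 → x ≠ 2 →
      LocalOn (segment N ((0 : Fin 4) * p) (((0 : Fin 4) + 1) * p) ∪
        segment N ((2 : Fin 4) * p) (((2 : Fin 4) + 1) * p))ᶜ (onCell (α := Fin d) h x c) := by
    intro x c h0 h2
    refine (localOn_onCell h x c).mono fun s hs => ?_
    rintro (h3 | h3)
    · exact Set.disjoint_left.1 (cell_disjoint h0) hs h3
    · exact Set.disjoint_left.1 (cell_disjoint h2) hs h3
  have := hg (onCell h 1 c₁ ⊙ onCell h 3 c₃) ((hloc 1 c₁ (by decide) (by decide)).hadamard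
    (hloc 3 c₃ (by decide) (by decide)))
  rw [pairing_prod_ringOp h A _ ![a₁, c₁, a₂, c₃] (fun i j => by
    simp only [Fin.prod_univ_four, onCell, Matrix.hadamard_apply, Matrix.of_apply,
      Matrix.cons_val]
    ring)] at this
  refine hXY ?_
  rw [← this]
  simp [List.ofFn_succ, mul_assoc]

/-- `a₁` is blind to `C` and `a₂` to `B`, so their product annihilates both summands. Since `a₁`
alone does not annihilate, `a₂` does, and `a₂` acts on `C` as an arbitrary letter. -/
theorem ringOp_eq_zero_of_onQuarters_independent {q t : ℕ} (h : 12 * q = N) (ht : t ≤ q)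
    (hv : 0 < v) {B : LocalTensor (Fin q → Fin d) v} {C : LocalTensor (Fin q → Fin d) u}
    (hBC : ∀ M, ∃ a, contract B a = M ∧ contract C a = 0)
    (hind : OnQuarters Independent (3 * q) t (ringOp h B + ringOp h C)) : ringOp h C = 0 := by
  classical
  ext i j
  set w := pairCells h (i, j) with hw
  -- Cells 1 and 7 are the middle cells of two opposite quarters of three cells each; t ≤ q keeps
  -- them inside the trimmed quarters.
  have hind' := isLocalProperty_independent.mono (disjoint_segment (by omega))
    (segment_subset (N := N) (lo := (1 : Fin 12) * q) (hi := ((1 : Fin 12) + 1) * q)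
      (by simp; omega) (by simp; omega))
    (segment_subset (N := N) (lo := (7 : Fin 12) * q) (hi := ((7 : Fin 12) + 1) * q)
      (by simp; omega) (by simp; omega)) hind
  obtain ⟨a₁, ha₁B, ha₁C⟩ := hBC 1
  obtain ⟨a', haB, haC⟩ := hBC (B (w 7).1 (w 7).2)
  have hsingle : ∀ {k : ℕ} (A : LocalTensor (Fin q → Fin d) k) s,
      contract A (Pi.single s 1) = A s.1 s.2 := fun A s => by
    rw [contract, Finset.sum_eq_single s]
    · simp
    · intro b _ hb
      rw [Pi.single_eq_of_ne hb, zero_smul]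
    · simp
  have hsub : ∀ {k : ℕ} (A : LocalTensor (Fin q → Fin d) k) a b,
      contract A (a - b) = contract A a - contract A b := fun A a b => by
    simp [contract, sub_smul]
  let a₂ : (Fin q → Fin d) × (Fin q → Fin d) → ℂ := Pi.single (w 7) 1 - a'
  have ha₂B : contract B a₂ = 0 := by rw [hsub, hsingle, haB, sub_self]
  have ha₂C : contract C a₂ = C (w 7).1 (w 7).2 := by rw [hsub, hsingle, haC, sub_zero]
  have hcell : Disjoint (segment N ((1 : Fin 12) * q) (((1 : Fin 12) + 1) * q))
      (segment N ((7 : Fin 12) * q) (((7 : Fin 12) + 1) * q)) := cell_disjoint (by decide)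
  refine (hind' _ _ (localOn_onCell h 1 a₁) (localOn_onCell h 7 a₂) fun g hg => ?_).elim
    (fun h1 => ?_) fun h1 => ?_
  · rw [pairing_add_right, hadamard_left_comm', pairing_ringOp_eq_zero h B 7 a₂ ha₂B,
      hadamard_left_comm', pairing_ringOp_eq_zero h C 1 a₁ ha₁C, add_zero]
    · exact ((localOn_onCell h 7 a₂).mono (Set.subset_compl_iff_disjoint_left.2 hcell)).hadamard
        (hg.mono (Set.compl_subset_compl.2 Set.subset_union_left))
    · exact ((localOn_onCell h 1 a₁).mono (Set.subset_compl_iff_disjoint_left.2 hcell.symm)).hadamard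
        (hg.mono (Set.compl_subset_compl.2 Set.subset_union_right))
  · exfalso
    -- With `a₁` on every cell the value for `B` is the trace of the identity, that is `v`, which is
    -- nonzero.
    let c : Fin 12 → (Fin q → Fin d) × (Fin q → Fin d) → ℂ := fun _ => a₁
    have h2 := h1 (prodOff h 1 c) (localOn_prodOff h 1 c)
    rw [pairing_add_right, pairing_ringOp_eq_zero h C 1 a₁ ha₁C _ (localOn_prodOff h 1 c), add_zero,
      pairing_prodOff_ringOp h B 1 c] at h2
    simp only [c, ha₁B, List.ofFn_const, List.prod_replicate, one_pow, Matrix.trace_one,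
      Fintype.card_fin, Nat.cast_eq_zero] at h2
    omega
  · let c : Fin 12 → (Fin q → Fin d) × (Fin q → Fin d) → ℂ := fun x =>
      if x = 7 then a₂ else Pi.single (w x) 1
    have hc7 : a₂ = c 7 := by simp [c]
    have h2 := h1 (prodOff h 7 c) (localOn_prodOff h 7 c)
    rw [pairing_add_right, pairing_ringOp_eq_zero h B 7 a₂ ha₂B _ (localOn_prodOff h 7 c), zero_add,
      hc7, pairing_prodOff_ringOp h C 7 c] at h2
    rw [Matrix.zero_apply, ← h2, ringOp, Matrix.of_apply, wordProd, List.map_ofFn]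
    congr 3
    funext x
    by_cases hx : x = 7
    · subst hx
      rw [← hc7, ha₂C]
      rfl
    · simp only [c, if_neg hx, hsingle]
      rfl

end Evaluation

/-! ### Schmidt rank bounds from ranks of transfer matrices. -/

section Schmidt

variable {n p N d χ v u : ℕ}

theorem contract_add {σ : Type} [Fintype σ] (A : LocalTensor σ χ) (a b : σ × σ → ℂ) :
    contract A (a + b) = contract A a + contract A b := by
  simp [contract, add_smul, Finset.sum_add_distrib]

theorem contract_smul {σ : Type} [Fintype σ] (A : LocalTensor σ χ) (c : ℂ) (a : σ × σ → ℂ) :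
    contract A (c • a) = c • contract A a := by
  simp [contract, Finset.smul_sum, mul_smul]

/-- Contraction with a tensor as a linear map. -/
def contractLin {σ : Type} [Fintype σ] (A : LocalTensor σ χ) :
    (σ × σ → ℂ) →ₗ[ℂ] Matrix (Fin χ) (Fin χ) ℂ where
  toFun := contract A
  map_add' := contract_add A
  map_smul' := contract_smul A

/-- A matrix entry of `U * M * W` as a linear functional of `M`. -/
def sandwichEntry {m k : ℕ} (U : Matrix (Fin m) (Fin χ) ℂ) (W : Matrix (Fin χ) (Fin k) ℂ)
    (a : Fin m) (b : Fin k) : Matrix (Fin χ) (Fin χ) ℂ →ₗ[ℂ] ℂ where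
  toFun M := (U * M * W) a b
  map_add' M K := by rw [Matrix.mul_add, Matrix.add_mul, Matrix.add_apply]
  map_smul' c M := by rw [Matrix.mul_smul, Matrix.smul_mul, Matrix.smul_apply, RingHom.id_apply]

/-- Writing S = W U through its rank, the trace depends only on the compressions U M W and U K W. -/
theorem exists_trace_eq_sum (S : Matrix (Fin χ) (Fin χ) ℂ) :
    ∃ α β : Fin S.rank × Fin S.rank → (Matrix (Fin χ) (Fin χ) ℂ →ₗ[ℂ] ℂ),
      ∀ M K, (M * S * K * S).trace = ∑ k, α k M * β k K := by
  obtain ⟨W, U, -, -, hS, -⟩ := exists_mul_eq_rank S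
  refine ⟨fun k => sandwichEntry U W k.1 k.2, fun k => sandwichEntry U W k.2 k.1, fun M K => ?_⟩
  calc (M * S * K * S).trace = (M * (W * U) * K * (W * U)).trace := by rw [← hS]
    _ = ((U * M * W) * (U * K * W)).trace := by
      rw [← Matrix.mul_assoc, Matrix.trace_mul_comm]
      simp only [Matrix.mul_assoc]
    _ = _ := by
      rw [Fintype.sum_prod_type]
      rfl

theorem prod_ofFn_four {G : Type} [Monoid G] (a b c : G) :
    (List.ofFn fun x : Fin 4 => if x = 0 then a else if x = 2 then b else c).prod =
      a * c * b * c := by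
  change a * (c * (b * (c * 1))) = _
  simp only [mul_one, mul_assoc]

theorem prod_ofFn_twelve {G : Type} [Monoid G] (a b c : G) :
    (List.ofFn fun x : Fin 12 => if x = 1 then a else if x = 7 then b else c).prod =
      c * (a * c ^ 5 * b * c ^ 4) := by
  change c * (a * (c * (c * (c * (c * (c * (b * (c * (c * (c * (c * 1))))))))))) = _
  simp only [pow_succ, pow_zero, one_mul, mul_one, mul_assoc]

theorem onQuarters_schmidtRankLE_ringOp_add (h : 4 * p = N) (B : LocalTensor (Fin p → Fin d) v)
    (C : LocalTensor (Fin p → Fin d) u) :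
    OnQuarters (SchmidtRankLE
      ((Fin (transferMatrix B).rank × Fin (transferMatrix B).rank) ⊕
        (Fin (transferMatrix C).rank × Fin (transferMatrix C).rank))) p 0
      (ringOp h B + ringOp h C) := by
  have hs0 : segment N 0 (p - 0) = segment N ((0 : Fin 4) * p) (((0 : Fin 4) + 1) * p) := by simp
  have hs2 : segment N (2 * p + 0) (3 * p - 0) =
      segment N ((2 : Fin 4) * p) (((2 : Fin 4) + 1) * p) := by simp
  rw [OnQuarters, hs0, hs2]
  obtain ⟨αB, βB, hB⟩ := exists_trace_eq_sum (transferMatrix B)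
  obtain ⟨αC, βC, hC⟩ := exists_trace_eq_sum (transferMatrix C)
  have hring : ∀ {k : ℕ} (A : LocalTensor (Fin p → Fin d) k) a₁ a₂,
      pairing (onCell h 0 a₁ ⊙ (onCell h 2 a₂ ⊙ traceOut
        (segment N ((0 : Fin 4) * p) (((0 : Fin 4) + 1) * p) ∪
          segment N ((2 : Fin 4) * p) (((2 : Fin 4) + 1) * p))ᶜ)) (ringOp h A) =
      (contract A a₁ * transferMatrix A * contract A a₂ * transferMatrix A).trace := by
    intro k A a₁ a₂
    rw [pairing_traceOut_ringOp h A (by decide)]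
    rw [prod_ofFn_four]
  refine ⟨fun k => Sum.elim αB (fun _ => 0) k ∘ₗ contractLin B ∘ₗ cellCoeff h +
      Sum.elim (fun _ => 0) αC k ∘ₗ contractLin C ∘ₗ cellCoeff h,
    fun k => Sum.elim βB (fun _ => 0) k ∘ₗ contractLin B ∘ₗ cellCoeff h +
      Sum.elim (fun _ => 0) βC k ∘ₗ contractLin C ∘ₗ cellCoeff h, fun f₁ f₂ hf₁ hf₂ => ?_⟩
  rw [pairing_add_right]
  conv_lhs => rw [hf₁.eq_onCell h, hf₂.eq_onCell h]
  rw [hring, hring, hB, hC, Fintype.sum_sum_type]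
  simp [contractLin]

/-- By injectivity the contractions on cells 1 and 7 are arbitrary. Restricted to U' Z W' and U' Y
W', the form becomes tr(Z Y), which is nondegenerate. The exponent 5 counts the cells on either arc
between cells 1 and 7. -/
theorem rank_mul_rank_le_of_onQuarters_schmidtRankLE {κ : Type} [Fintype κ] {q t : ℕ}
    (h : 12 * q = N) (ht : t ≤ q) {A : LocalTensor (Fin q → Fin d) χ} (hA : tensorSpan A = ⊤)
    (hS : OnQuarters (SchmidtRankLE κ) (3 * q) t (ringOp h A)) :
    (transferMatrix A ^ 5).rank * (transferMatrix A ^ 5).rank ≤ Fintype.card κ := by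
  have hS' := (isLocalProperty_schmidtRankLE κ).mono (disjoint_segment (by omega))
    (segment_subset (N := N) (lo := (1 : Fin 12) * q) (hi := ((1 : Fin 12) + 1) * q)
      (by simp; omega) (by simp; omega))
    (segment_subset (N := N) (lo := (7 : Fin 12) * q) (hi := ((7 : Fin 12) + 1) * q)
      (by simp; omega) (by simp; omega)) hS
  obtain ⟨α, β, hαβ⟩ := hS'
  set S := transferMatrix A ^ 5 with hSdef
  obtain ⟨-, -, W', U', -, hWU⟩ := exists_mul_eq_rank S
  have hring : ∀ a₁ a₂, (contract A a₁ * S * contract A a₂ * S).trace =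
      ∑ k, α k (onCell h 1 a₁) * β k (onCell h 7 a₂) := by
    intro a₁ a₂
    rw [← hαβ _ _ (localOn_onCell h 1 a₁) (localOn_onCell h 7 a₂),
      pairing_traceOut_ringOp h A (by decide), hSdef]
    set T := transferMatrix A with hT
    have hcyc : (contract A a₁ * T ^ 5 * contract A a₂ * T ^ 5).trace =
        (T * (contract A a₁ * T ^ 5 * contract A a₂ * T ^ 4)).trace := by
      rw [Matrix.trace_mul_comm T, pow_succ T 4]
      simp only [mul_assoc]
    rw [hcyc, prod_ofFn_twelve]
  obtain ⟨sec, hsec⟩ := (contractLin A).exists_rightInverse_of_surjective (by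
    rw [LinearMap.range_eq_top]
    exact exists_contract_eq hA)
  have hsec' : ∀ M, contract A (sec M) = M := fun M => LinearMap.congr_fun hsec M
  let Λ : Matrix (Fin S.rank) (Fin S.rank) ℂ →ₗ[ℂ] (κ → ℂ) :=
    { toFun := fun Y k => β k (onCell h 7 (sec (U' * Y * W')))
      map_add' := fun Y Z => by
        funext k
        rw [Matrix.mul_add, Matrix.add_mul, map_add]
        exact map_add (β k) (onCell h 7 _) (onCell h 7 _)
      map_smul' := fun c Y => by
        funext k
        rw [Matrix.mul_smul, Matrix.smul_mul, map_smul]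
        exact map_smul (β k) c (onCell h 7 _) }
  have hΛ : Function.Injective Λ := by
    rw [← LinearMap.ker_eq_bot, LinearMap.ker_eq_bot']
    intro Y hY
    have hY0 : ∀ Z : Matrix (Fin S.rank) (Fin S.rank) ℂ, (Z * Y).trace = 0 := by
      intro Z
      have h1 := hring (sec (U' * Z * W')) (sec (U' * Y * W'))
      have h2 : ∀ k, β k (onCell h 7 (sec (U' * Y * W'))) = 0 := fun k => congrFun hY k
      simp only [h2, mul_zero, Finset.sum_const_zero, hsec'] at h1
      rw [← h1]
      calc (Z * Y).trace = (Z * (W' * S * U') * Y * (W' * S * U')).trace := by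
            rw [hWU, mul_one, mul_one]
        _ = _ := by
          rw [← Matrix.mul_assoc _ (W' * S) U', Matrix.trace_mul_comm _ U']
          simp only [Matrix.mul_assoc]
    ext a b
    have := hY0 (Matrix.single b a 1)
    rw [Matrix.trace_single_mul] at this
    simpa using this
  have := LinearMap.finrank_le_finrank_of_injective hΛ
  simpa [Module.finrank_matrix] using this

end Schmidt

/-! ### Removing the remainder, and the conclusion. -/

section Main

variable {n p N d χ v u : ℕ}

theorem top_pow_eq_top {k : ℕ} (hk : 1 ≤ k) :
    (⊤ : Submodule ℂ (Matrix (Fin χ) (Fin χ) ℂ)) ^ k = ⊤ := by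
  induction k, hk using Nat.le_induction with
  | base => exact pow_one _
  | succ k _ ih =>
    refine eq_top_iff.2 fun M _ => ?_
    rw [pow_succ, ih, ← mul_one M]
    exact Submodule.mul_mem_mul Submodule.mem_top Submodule.mem_top

theorem tensorSpan_blockTensor_eq_top {α : Type} {A : LocalTensor (Fin p → α) χ}
    (hA : tensorSpan A = ⊤) {k : ℕ} (hk : 1 ≤ k) : tensorSpan (blockTensor k A) = ⊤ := by
  rw [tensorSpan_blockTensor, hA, top_pow_eq_top hk]

theorem exists_generatedBy_of_dvd {ρ : ChainFamily d} {A : LocalTensor (Fin p → Fin d) χ}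
    (hA : GeneratedBy ρ p A) {q : ℕ} (hq : 1 ≤ q) (hpq : p ∣ q) :
    ∃ A' : LocalTensor (Fin q → Fin d) χ, GeneratedBy ρ q A' ∧
      (IsStrongInjectiveTensor A → IsStrongInjectiveTensor A') := by
  obtain ⟨k, rfl⟩ := exists_eq_mul_left_of_dvd hpq
  have hk : 1 ≤ k := Nat.pos_of_mul_pos_right hq
  refine ⟨blockTensor k A, hA.blockTensor hk, fun h => ⟨?_, ?_⟩⟩
  · rw [injective_virtualToPhysical_iff]
    exact tensorSpan_blockTensor_eq_top ((injective_virtualToPhysical_iff A).1 h.injective) hk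
  · rw [transferMatrix_blockTensor]
    exact h.transfer.pow hk

theorem trace_ringOp (h : n * p = N) (A : LocalTensor (Fin p → Fin d) χ) :
    (ringOp h A).trace = (transferMatrix A ^ n).trace := by
  have h1 : ∀ i j : Fin N → Fin d, traceOut Set.univ i j = traceCoeff (Fin N → Fin d) (i, j) := by
    intro i j
    simp [traceOut, traceCoeff, funext_iff]
  rw [← pairing_traceOut_univ, pairing_prod_ringOp h A _ (fun _ => traceCoeff (Fin p → Fin d))
    (fun i j => (h1 i j).trans (traceCoeff_eq_prod h i j)), List.ofFn_const, List.prod_replicate,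
    transferMatrix_eq_contract]

theorem ringOp_congr {n' : ℕ} (hp : 0 < p) (h : n * p = N) (h' : n' * p = N)
    (A : LocalTensor (Fin p → Fin d) χ) : ringOp h A = ringOp h' A := by
  obtain rfl : n = n' := Nat.eq_of_mul_eq_mul_right hp (h.trans h'.symm)
  rfl

/-- Tracing out the middle of three blocks kills `C` and leaves X T_B Y for `B`; one nonzero entry
of T_B suffices for such products to span all matrices. -/
theorem exists_contract_blockTensor_three {B : LocalTensor (Fin p → Fin d) v}
    {C : LocalTensor (Fin p → Fin d) u} (hB : tensorSpan B = ⊤) (hTB : transferMatrix B ≠ 0)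
    (hTC : transferMatrix C = 0) (M : Matrix (Fin v) (Fin v) ℂ) :
    ∃ a, contract (blockTensor 3 B) a = M ∧ contract (blockTensor 3 C) a = 0 := by
  let K := (LinearMap.ker (contractLin (blockTensor 3 C))).map (contractLin (blockTensor 3 B))
  suffices hM : M ∈ K by
    obtain ⟨a, ha, rfl⟩ := hM
    exact ⟨a, rfl, ha⟩
  obtain ⟨a, b, hab⟩ : ∃ a b, transferMatrix B a b ≠ 0 := by
    by_contra! h0
    exact hTB (Matrix.ext h0)
  have hmem : ∀ X Y, X * transferMatrix B * Y ∈ K := by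
    intro X Y
    obtain ⟨x, rfl⟩ := exists_contract_eq hB X
    obtain ⟨y, rfl⟩ := exists_contract_eq hB Y
    refine ⟨prodCoeff ![x, traceCoeff (Fin p → Fin d), y], ?_, ?_⟩
    · change contract _ _ = 0
      rw [contract_blockTensor]
      simp [List.ofFn_succ, ← transferMatrix_eq_contract, hTC]
    · change contract _ _ = _
      rw [contract_blockTensor]
      simp [List.ofFn_succ, ← transferMatrix_eq_contract, mul_assoc]
  rw [Matrix.matrix_eq_sum_single M]
  refine Submodule.sum_mem _ fun i _ => Submodule.sum_mem _ fun j _ => ?_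
  have := hmem (Matrix.single i a (M i j * (transferMatrix B a b)⁻¹)) (Matrix.single b j 1)
  rwa [Matrix.single_mul_mul_single, mul_one, mul_assoc, inv_mul_cancel₀ hab, mul_one] at this

theorem one_le_nonzeroRootCount {T : Matrix (Fin χ) (Fin χ) ℂ} (hT : HasUniqueLargestEigenvalue T) :
    1 ≤ nonzeroRootCount T := by
  classical
  obtain ⟨r, hr, h1, -⟩ := (hasUniqueLargestEigenvalue_iff T).1 hT
  refine Multiset.card_pos_iff_exists_mem.2 ⟨(r : ℂ), Multiset.mem_filter.2 ⟨?_, ?_⟩⟩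
  · exact Multiset.count_pos.1 (by omega)
  · exact_mod_cast hr.ne'

/-- A tensor whose transfer matrix has a unique largest eigenvalue is, up to a tensor that does not
carry this eigenvalue, a tensor that becomes injective after grouping. -/
theorem exists_eventually_injective_component {σ : Type} [Fintype σ] (A : LocalTensor σ χ)
    (hA : HasUniqueLargestEigenvalue (transferMatrix A)) :
    ∃ (v u : ℕ) (B : LocalTensor σ v) (C : LocalTensor σ u), TraceSplits A B C ∧
      HasUniqueLargestEigenvalue (transferMatrix B) ∧ ∃ l, ∀ k, l ≤ k → tensorSpan B ^ k = ⊤ := by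
  obtain ⟨r, hr, h1, h2⟩ := (hasUniqueLargestEigenvalue_iff _).1 hA
  have hr0 : (r : ℂ) ≠ 0 := by exact_mod_cast hr.ne'
  obtain ⟨v, u, B, C, hs, hirr, hroot⟩ := exists_irreducible_component A hr0 (by omega)
  have hcount := count_roots_eq_add_of_trace_pow fun k (_ : 1 ≤ k) => hs.trace_transfer_pow k
  have hB : HasUniqueLargestEigenvalue (transferMatrix B) := by
    refine (hasUniqueLargestEigenvalue_iff _).2 ⟨r, hr, ?_, fun z hz hzr => ?_⟩
    · have := hcount r hr0
      omega
    · rcases eq_or_ne z 0 with rfl | h0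
      · simpa using hr
      · exact h2 z (by rw [hcount z h0]; omega) hzr
  exact ⟨v, u, B, C, hs, hB, eventually_tensorSpan_pow_eq_top hirr hB⟩

theorem nonzeroRootCount_eq_zero_of_isLinked {t p' : ℕ} {ρ σ : ChainFamily d} (hp : 1 ≤ p)
    (hpe : Even p) {A : LocalTensor (Fin p → Fin d) χ} (hAg : GeneratedBy ρ p A)
    (hA : tensorSpan A = ⊤) {D : LocalTensor (Fin p → Fin d) p'} (hDg : GeneratedBy σ p D)
    {B : LocalTensor (Fin p → Fin d) v} {C : LocalTensor (Fin p → Fin d) u}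
    (hs : TraceSplits D B C) (hB : 1 ≤ nonzeroRootCount (transferMatrix B))
    (hsum : nonzeroRootCount (transferMatrix A) =
      nonzeroRootCount (transferMatrix B) + nonzeroRootCount (transferMatrix C))
    (hl : ∀ N, 1 ≤ N → Even N → IsLinked t (ρ N) (σ N)) :
    nonzeroRootCount (transferMatrix C) = 0 := by
  -- Large enough for the ranks of all three transfer powers to have stabilized, and for a cell to
  -- be longer than `t`.
  obtain ⟨m, hm⟩ : ∃ m, m = χ + v + u + t + 1 := ⟨_, rfl⟩
  have hqm : m ≤ m * p := Nat.le_mul_of_pos_right m hp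
  obtain ⟨N, hN⟩ : ∃ N, N = 12 * (m * p) := ⟨_, rfl⟩
  have h12 : 12 * (m * p) = N := hN.symm
  have h4 : 4 * (3 * (m * p)) = N := by omega
  have hσ : σ N = ringOp h4 (blockTensor 3 (blockTensor m B)) +
      ringOp h4 (blockTensor 3 (blockTensor m C)) := by
    rw [← ((hs.blockTensor m).blockTensor 3).ringOp h4]
    exact generatedBy_iff.1 ((hDg.blockTensor (k := m) (by omega)).blockTensor (by omega)) _ _ _
      (by omega)
  have hρ : ρ N = ringOp h12 (blockTensor m A) :=
    generatedBy_iff.1 (hAg.blockTensor (k := m) (by omega)) _ _ _ (by omega)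
  have hlN := hl N (by omega) (hN ▸ (hpe.mul_left m).mul_left 12)
  have hS := hlN.backward (isLocalProperty_schmidtRankLE _) (3 * (m * p)) h4.symm
    ((hpe.mul_left m).mul_left 3) (by omega)
    (hσ ▸ onQuarters_schmidtRankLE_ringOp_add h4 (blockTensor 3 (blockTensor m B))
      (blockTensor 3 (blockTensor m C)))
  rw [hρ] at hS
  have hle := rank_mul_rank_le_of_onQuarters_schmidtRankLE h12 (by omega)
    (tensorSpan_blockTensor_eq_top hA (by omega)) hS
  simp only [Fintype.card_sum, Fintype.card_prod, Fintype.card_fin, transferMatrix_blockTensor,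
    ← pow_mul] at hle
  rw [rank_pow_eq_nonzeroRootCount _ (by omega), rank_pow_eq_nonzeroRootCount _ (by omega),
    rank_pow_eq_nonzeroRootCount _ (by omega), hsum] at hle
  -- The inequality is (b + c)² ≤ b² + c² with b ≥ 1, hence c = 0.
  nlinarith

theorem isStrongInjective_of_isLinked {t : ℕ} {ρ σ : ChainFamily d} (hρ : IsStrongInjective ρ)
    (hσ : ∃ p : ℕ, 1 ≤ p ∧ ∃ (χ : ℕ) (A : LocalTensor (Fin p → Fin d) χ), GeneratedBy σ p A)
    (hl : ∀ N, 1 ≤ N → Even N → IsLinked t (ρ N) (σ N)) : IsStrongInjective σ := by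
  obtain ⟨p, hp, χ, A₀, hA₀, hA₀g⟩ := hρ
  obtain ⟨p', hp', χ', D₀, hD₀g⟩ := hσ
  -- A common unit cell for both tensors, of even length so that every ring of such cells carries a
  -- circuit.
  obtain ⟨q, hq⟩ : ∃ q, q = 2 * (p * p') := ⟨_, rfl⟩
  have hq1 : 1 ≤ q := by have := Nat.mul_pos hp hp'; omega
  have hqe : Even q := ⟨p * p', by omega⟩
  obtain ⟨A, hAg, hA⟩ := exists_generatedBy_of_dvd hA₀g hq1
    (hq ▸ Dvd.dvd.mul_left (Dvd.intro p' rfl) 2)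
  obtain ⟨D, hDg, -⟩ := exists_generatedBy_of_dvd hD₀g hq1
    (hq ▸ Dvd.dvd.mul_left (Dvd.intro_left p rfl) 2)
  have hAs := (injective_virtualToPhysical_iff A).1 (hA hA₀).injective
  have htr : ∀ k, 1 ≤ k → (transferMatrix D ^ k).trace = (transferMatrix A ^ k).trace := by
    intro k hk
    rw [← trace_ringOp rfl, ← trace_ringOp rfl, ← generatedBy_iff.1 hDg k _ rfl hk,
      ← generatedBy_iff.1 hAg k _ rfl hk]
    exact (hl (k * q) (Nat.mul_pos hk hq1) (hqe.mul_left k)).trace_eq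
  have hDT := (hA hA₀).transfer.of_count_eq (count_roots_eq_of_trace_pow htr)
  obtain ⟨v, u, B, C, hs, hBT, l, hspan⟩ := exists_eventually_injective_component D hDT
  have hB1 := one_le_nonzeroRootCount hBT
  have hsum : nonzeroRootCount (transferMatrix A) =
      nonzeroRootCount (transferMatrix B) + nonzeroRootCount (transferMatrix C) :=
    nonzeroRootCount_eq_add_of_trace_pow fun k hk => by rw [← htr k hk, hs.trace_transfer_pow]
  have hC0 := nonzeroRootCount_eq_zero_of_isLinked hq1 hqe hAg hAs hDg hs hB1 hsum hl
  have hCm : ∀ m, u ≤ m → transferMatrix C ^ m = 0 := fun m hm => by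
    have := rank_pow_eq_nonzeroRootCount (transferMatrix C) hm
    rw [hC0] at this
    rw [Matrix.rank, Submodule.finrank_eq_zero, LinearMap.range_eq_bot] at this
    exact Matrix.ext_of_mulVec_single fun i => by
      rw [← mulVecLin_apply, this, LinearMap.zero_apply, zero_mulVec]
  have hBm : ∀ m, transferMatrix B ^ m ≠ 0 := fun m hm => by
    have := rank_pow_eq_nonzeroRootCount (transferMatrix B) (Nat.le_add_left v m)
    rw [pow_add, hm, zero_mul, Matrix.rank_zero] at this
    omega
  have hv : 0 < v := by
    have := rank_pow_eq_nonzeroRootCount (transferMatrix B) le_rfl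
    have := Matrix.rank_le_width (transferMatrix B ^ v)
    omega
  -- Blocks of `m` cells make `B` injective, kill T_C and exceed `t` sites.
  obtain ⟨m, hm⟩ : ∃ m, m = l + u + t + 1 := ⟨_, rfl⟩
  -- 36 = 12 · 3: twelve large cells of three blocks each, the middle block being traced out. For
  -- larger `n` the blocks grow to `n * m` cells, so every ring of the final unit cell is covered.
  have hzero : ∀ n, 1 ≤ n → ∀ N (h : n * (36 * m) * q = N), ringOp h C = 0 := by
    intro n hn N h
    have hmn : m ≤ n * m := Nat.le_mul_of_pos_left m hn
    have hmq : n * m ≤ n * m * q := Nat.le_mul_of_pos_right _ hq1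
    have hN : n * (36 * m) * q = 36 * (n * m * q) := by ring
    have h12 : 12 * (3 * (n * m * q)) = N := by omega
    have h4 : 4 * (3 * (3 * (n * m * q))) = N := by omega
    have hρN : ρ N = ringOp h4 (blockTensor 3 (blockTensor 3 (blockTensor (n * m) A))) :=
      generatedBy_iff.1 (((hAg.blockTensor (k := n * m) (by omega)).blockTensor
        (by omega)).blockTensor (by omega)) _ _ _ (by omega)
    have hσN : σ N = ringOp h12 (blockTensor 3 (blockTensor (n * m) B)) +
        ringOp h12 (blockTensor 3 (blockTensor (n * m) C)) := by
      rw [← ((hs.blockTensor (n * m)).blockTensor 3).ringOp h12]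
      exact generatedBy_iff.1 ((hDg.blockTensor (k := n * m) (by omega)).blockTensor (by omega))
        _ _ _ (by omega)
    have hlN := hl N (by omega) (h ▸ hqe.mul_left _)
    have hind := hlN.forward isLocalProperty_independent (3 * (3 * (n * m * q))) h4.symm
      (((hqe.mul_left _).mul_left 3).mul_left 3) (by omega) (hρN ▸ onQuarters_independent_ringOp h4
        (tensorSpan_blockTensor_eq_top (tensorSpan_blockTensor_eq_top
          (tensorSpan_blockTensor_eq_top hAs (by omega)) (by omega)) (by omega)))
    rw [hσN] at hind
    have hC := ringOp_eq_zero_of_onQuarters_independent h12 (by omega) hv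
      (exists_contract_blockTensor_three (by rw [tensorSpan_blockTensor, hspan _ (by omega)])
        (by rw [transferMatrix_blockTensor]; exact hBm _)
        (by rw [transferMatrix_blockTensor]; exact hCm _ (by omega))) hind
    have h36 : 36 * (n * m * q) = N := by omega
    have h36' : 36 * (n * m) * q = N := by rw [mul_assoc]; exact h36
    rw [ringOp_blockTensor h12 h36, ringOp_blockTensor h36 h36'] at hC
    rw [← hC]
    exact ringOp_congr hq1 _ _ C
  refine ⟨36 * m * q, Nat.mul_pos (by omega) hq1, v, blockTensor (36 * m) B, ⟨?_, ?_⟩, ?_⟩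
  · rw [injective_virtualToPhysical_iff, tensorSpan_blockTensor, hspan _ (by omega)]
  · rw [transferMatrix_blockTensor]
    exact hBT.pow (by omega)
  · rw [generatedBy_iff]
    intro n N h hn
    have h' : n * (36 * m) * q = N := by rw [mul_assoc]; exact h
    rw [ringOp_blockTensor h h', generatedBy_iff.1 hDg _ N h' (Nat.mul_pos hn (by omega)),
      hs.ringOp h', hzero n hn N h', add_zero]

theorem IsMPDO.exists_generatedBy {ρ : ChainFamily d} (hρ : IsMPDO ρ) :
    ∃ p : ℕ, 1 ≤ p ∧ ∃ (χ : ℕ) (A : LocalTensor (Fin p → Fin d) χ), GeneratedBy ρ p A := by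
  obtain ⟨p, hp, hA, -⟩ := hρ
  exact ⟨p, hp, hA⟩

end Main

end StrongInjectiveMPDO

theorem mainTheorem4 (d t : ℕ)
    (ρ ρ' : StrongInjectiveMPDO.ChainFamily d)
    (hρ : StrongInjectiveMPDO.IsMPDO ρ) (hρ' : StrongInjectiveMPDO.IsMPDO ρ')
    (𝒩 : (N : ℕ) → Module.End ℂ (StrongInjectiveMPDO.ChainOp (Fin d) N))
    (h𝒩 : ∀ N : ℕ, 1 ≤ N → Even N → StrongInjectiveMPDO.IsNondegenerateBrickwork t (𝒩 N))
    (h : ∀ N : ℕ, 1 ≤ N → Even N → ρ' N = 𝒩 N (ρ N)) :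
    StrongInjectiveMPDO.IsStrongInjective ρ' ↔ StrongInjectiveMPDO.IsStrongInjective ρ := by
  have hl : ∀ N, 1 ≤ N → Even N → StrongInjectiveMPDO.IsLinked t (ρ N) (ρ' N) :=
    fun N hN hNe => h N hN hNe ▸ (h𝒩 N hN hNe).isLinked hNe (ρ N)
  -- The link is symmetric, so the direction against the circuit needs no inverse circuit of
  -- channels.
  exact ⟨fun hs => StrongInjectiveMPDO.isStrongInjective_of_isLinked hs hρ.exists_generatedBy
    fun N hN hNe => (hl N hN hNe).symm,
    fun hs => StrongInjectiveMPDO.isStrongInjective_of_isLinked hs hρ'.exists_generatedBy hl⟩
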